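/- **Model.** A state $\omega\in\{0,1\}$ has prior probability $\pi=\Pr(\omega=1)\in(0,1)$. Each of two senders $i\in\{1,2\}$ is independently informed with probability $p_i\in(0,1)$; if informed, he observes a signal drawn, independently of the other sender conditional on the state, from a density $f(\cdot\mid\omega)$ with support $S=[\underline s,\overline s]\subseteq[0,1]$ in both states, signals being normalized so that the posterior probability of $\omega=1$ given a signal $s$ is $s$. An informed sender with signal $s$ sends either $s$ (disclosure) or $\phi$ (nondisclosure); an uninformed sender can only send $\phi$. A decision maker (DM) observes both messages and forms the belief $\beta_{DM}$ that $\omega=1$ by Bayes' rule, a disclosed signal (on or off path) being proof of that signal. Both senders are upward biased: sender $i$'s payoff is $\beta_{DM}-c\cdot\mathbf 1\{m_i\neq\phi\}$, where $c\in\mathbb R$ is a common message cost. Equilibrium means perfect Bayesian equilibrium, every type in $S$ choosing its message optimally. Sender $i$ has disclosure threshold $t_i\in S$ if he discloses all signals above $t_i$ and conceals all signals below $t_i$. An equilibrium is smallest (largest) if every equilibrium is in threshold strategies and has both thresholds weakly larger (smaller) than it. It is $k$-maximal if every equilibrium is in threshold strategies and it maximizes sender $k$'s threshold and minimizes the other sender's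 threshold across all equilibria. **Proposition.** For any $i\in\{1,2\}$, with $j\ne i$: 1. Let $c\le 0$. A smallest and a largest equilibrium exist; they are respectively the best and the worst equilibrium for the DM's ex-ante welfare, whatever her decision problem with bounded utility $u_{DM}(a,\omega)$. An increase in $p_i$, or a decrease in $c$, weakly lowers both senders' thresholds in both the best (smallest) and the worst (largest) equilibrium. 2. Let $c>0$. An $i$-maximal and a $j$-maximal equilibrium exist, and an increase in $p_i$ weakly lowers sender $i$'s threshold and weakly raises sender $j$'s threshold in both of them. A decrease in $c$ (lower disclosure cost) has ambiguous effects on equilibrium thresholds: for all $k,l\in\{1,2\}$ there are an information structure and probabilities $p_1,p_2$ for which some decrease of the cost from $c$ to $c'$ with $0<c'<c$ strictly lowers sender $l$'s threshold in the $k$-maximal equilibrium, and some other such decrease strictly raises it. -/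

import Mathlib

open MeasureTheory Set

noncomputable section

namespace Disclosure

/-- The information structure that is common to all players. States and senders are both indexed by
`Fin 2`; beliefs are probabilities of state `1`. An informed sender's signal has, in state `ω`, the
density `f ω`; the two state-contingent distributions have common support `S = [lo, hi] ⊆ [0, 1]`;
and signals are identified with private beliefs: the posterior of state `1` given signal `s`
is `s`. -/
structure Info where
  lo : ℝ
  hi : ℝ
  lo_nonneg : 0 ≤ lo
  lo_lt_hi : lo < hi
  hi_le_one : hi ≤ 1
  /-- common prior probability of state `1` -/
  prior : ℝ
  prior_mem : prior ∈ Ioo (0 : ℝ) 1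
  f : Fin 2 → ℝ → ℝ
  f_measurable : ∀ ω, Measurable (f ω)
  f_nonneg : ∀ ω s, 0 ≤ f ω s
  f_total : ∀ ω, ∫ s in Icc lo hi, f ω s = 1
  /-- no nondegenerate subinterval of `[lo, hi]` is null, so the support is all of `[lo, hi]` -/
  f_support : ∀ ω a b, lo ≤ a → a < b → b ≤ hi → 0 < ∫ s in Icc a b, f ω s
  /-- Bayes' rule: `s = π f(s|1) / (π f(s|1) + (1 - π) f(s|0))` wherever the density is positive -/
  f_posterior : ∀ᵐ s, s ∈ Icc lo hi →
    s * (prior * f 1 s + (1 - prior) * f 0 s) = prior * f 1 s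

/-- A profile of (behavioural) strategies: `σ i s` is the probability with which sender `i`
discloses when informed with signal `s`. An uninformed sender has no choice. -/
abbrev Profile := Fin 2 → ℝ → ℝ

variable (I : Info) (p : Fin 2 → ℝ) (c : ℝ) (σ : Profile)

/-- Probability, in state `ω`, of nondisclosure by sender `i`, who is informed with
probability `p i`. -/
def ndProb (i ω : Fin 2) : ℝ :=
  1 - p i + p i * ∫ s in Icc I.lo I.hi, (1 - σ i s) * I.f ω s

/-- Expectation, in state `ω`, of a function of sender `i`'s message. A message is `some s`
(signal `s` is disclosed) or `none` (nondisclosure). -/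
def msgExp (i ω : Fin 2) (g : Option ℝ → ℝ) : ℝ :=
  (∫ s in Icc I.lo I.hi, p i * σ i s * I.f ω s * g (some s)) + ndProb I p σ i ω * g none

/-- Likelihood of a message of sender `i` in state `ω`, up to a factor that does not depend on `ω`.
A disclosed signal `s` proves the signal and so, alone, moves the prior to the belief `s`. -/
def lik (i ω : Fin 2) : Option ℝ → ℝ
  | some s => if ω = 1 then s / I.prior else (1 - s) / (1 - I.prior)
  | none => ndProb I p σ i ω

/-- The DM's belief after the message pair `m`, by Bayes' rule with messages independent
conditional on the state. -/
def belief (m : Fin 2 → Option ℝ) : ℝ :=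
  (I.prior * ∏ k, lik I p σ k 1 (m k)) /
    (I.prior * (∏ k, lik I p σ k 1 (m k)) + (1 - I.prior) * ∏ k, lik I p σ k 0 (m k))

/-- Expectation of the DM's belief when sender `i` sends `m` and the other sender's message is
drawn as in state `ω`. -/
def expBelief (i ω : Fin 2) (m : Option ℝ) : ℝ :=
  msgExp I p σ i.rev ω (fun m' => belief I p σ (fun k => if k = i then m else m'))

/-- Expected payoff of the upward-biased sender `i` with signal (hence private belief) `s` from
message `m`: the expected belief of the DM, less the message cost `c` in case of disclosure. -/
def payoff (i : Fin 2) (s : ℝ) (m : Option ℝ) : ℝ :=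
  s * expBelief I p σ i 1 m + (1 - s) * expBelief I p σ i 0 m - (if m = none then 0 else c)

/-- Perfect Bayesian equilibrium of the disclosure game with two upward-biased senders: every
informed type of either sender chooses its message optimally (it may randomize), given the other sender's
strategy and the DM's belief updating. -/
def IsEquilibrium : Prop :=
  ∀ i, Measurable (σ i) ∧ ∀ s ∈ Icc I.lo I.hi, σ i s ∈ Icc (0 : ℝ) 1 ∧
    ∀ r ∈ Icc (0 : ℝ) 1,
      r * payoff I p c σ i s (some s) + (1 - r) * payoff I p c σ i s none ≤
        σ i s * payoff I p c σ i s (some s) + (1 - σ i s) * payoff I p c σ i s none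

/-- The profile `σ` consists of threshold strategies with the thresholds `t ∈ [lo, hi]²`: sender `i`
discloses all signals above `t i` and conceals all signals below it. -/
def HasThresholds (t : Fin 2 → ℝ) : Prop :=
  ∀ i, t i ∈ Icc I.lo I.hi ∧ ∀ s ∈ Icc I.lo I.hi, (t i < s → σ i s = 1) ∧ (s < t i → σ i s = 0)

/-- `t` is the pair of thresholds of some equilibrium. -/
def IsEqThresholds (t : Fin 2 → ℝ) : Prop :=
  ∃ σ, IsEquilibrium I p c σ ∧ HasThresholds I σ t

/-- `t` is the smallest equilibrium: every equilibrium is in threshold strategies, with both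
thresholds at least as large. -/
def IsSmallest (t : Fin 2 → ℝ) : Prop :=
  IsEqThresholds I p c t ∧
    ∀ σ, IsEquilibrium I p c σ → ∃ t', HasThresholds I σ t' ∧ ∀ k, t k ≤ t' k

/-- `t` is the largest equilibrium. -/
def IsLargest (t : Fin 2 → ℝ) : Prop :=
  IsEqThresholds I p c t ∧
    ∀ σ, IsEquilibrium I p c σ → ∃ t', HasThresholds I σ t' ∧ ∀ k, t' k ≤ t k

/-- `t` is the `i`-maximal equilibrium: across all equilibria it maximizes the threshold of `i` and
minimizes the threshold of the other sender. -/
def IsMaximalFor (i : Fin 2) (t : Fin 2 → ℝ) : Prop :=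
  IsEqThresholds I p c t ∧
    ∀ σ, IsEquilibrium I p c σ → ∃ t', HasThresholds I σ t' ∧ t' i ≤ t i ∧ t i.rev ≤ t' i.rev

/-- Ex-ante expected utility of a DM with action set `A` and utility `u a ω`, who chooses an optimal
action given her belief. -/
def welfare {A : Type} (u : A → Fin 2 → ℝ) : ℝ :=
  let V : ℝ → ℝ := fun β => ⨆ a, (β * u a 1 + (1 - β) * u a 0)
  let W : Fin 2 → ℝ := fun ω =>
    msgExp I p σ 0 ω (fun m₀ => msgExp I p σ 1 ω (fun m₁ => V (belief I p σ ![m₀, m₁])))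
  I.prior * W 1 + (1 - I.prior) * W 0

/-- `σ` is an equilibrium that is best for the DM among all equilibria, whatever her (bounded)
decision problem. -/
def IsBestForDM : Prop :=
  IsEquilibrium I p c σ ∧
    ∀ (A : Type) [Nonempty A] (u : A → Fin 2 → ℝ), (∃ K, ∀ a ω, |u a ω| ≤ K) →
      ∀ σ', IsEquilibrium I p c σ' → welfare I p σ' u ≤ welfare I p σ u

/-- `σ` is an equilibrium that is worst for the DM among all equilibria, whatever her (bounded)
decision problem. -/
def IsWorstForDM : Prop :=
  IsEquilibrium I p c σ ∧
    ∀ (A : Type) [Nonempty A] (u : A → Fin 2 → ℝ), (∃ K, ∀ a ω, |u a ω| ≤ K) →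
      ∀ σ', IsEquilibrium I p c σ' → welfare I p σ u ≤ welfare I p σ' u

end Disclosure

end

/-!
Let `d` be the rate at which the other sender discloses, as a function of his signal, and let `η`
be the decision maker's interim belief after the silence of a sender with signal `s`. Disclosure
pays `s - c`, because a belief is a martingale for whoever holds it. After silence the decision
maker starts from `η` while the sender believes `s`, and her expected posterior is `s + (η - s) *
residual I d η` (`expBelief_eq`). The number `residual I d η` in `(0, 1]` is her expected posterior
variance relative to the prior variance `η (1 - η)`. So a type discloses if and only if `(s - η) *
residual I d η` is at least `c`. This is increasing in `s`, hence all equilibria are in thresholds,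
characterized by indifference of the threshold types up to corners (`isEqThresholds_iff`).

The residual falls as the other sender discloses more (`residual_anti`, from concavity and
homogeneity of `psi η`), so more disclosure scales `(s - η) * residual I d η` towards `0`. If `c ≤
0`, this makes thresholds strategic complements, and if `c ≥ 0`, strategic substitutes. A sender
who is more likely to be informed faces a lower `η`, which raises his gain from disclosure
(`advantage_cutoff_mono`). A Tarski-type argument (`exists_greatest_balanced`), run in coordinates
that carry the signs `e`, yields the smallest, the largest and the maximal equilibria together. It
also shows that they dominate all points that are merely stable in one direction
(`IsExtremal.of_isStable`); since a change of parameters preserves such stability in one of the two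
directions, the comparative statics follow.

For the decision maker, welfare is an integral of the sublinear function `value` of the masses of
the two states, so that separating signals from silence can only raise it (`hearing_mono`). Hence
lower thresholds are better for any decision problem.

For the ambiguous effect of a positive cost, one sender is rarely informed, the other one nearly
always, and signals are concentrated just below the top (`bumpInfo`). At cost `2` nobody discloses.
At cost `19/50` the well-informed sender conceals the concentration, and the other one discloses
his best signals. At cost `69/200` the well-informed sender discloses the concentration, and he
reveals so much that the other one no longer discloses anything. These facts hold in every
equilibrium, so they apply to either maximal one.
-/

namespace Disclosure

section

/-! ### Densities and disclosure rates -/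

lemma Info.integrableOn_f (I : Info) (ω : Fin 2) : IntegrableOn (I.f ω) (Icc I.lo I.hi) :=
  integrable_of_integral_eq_one (I.f_total ω)

lemma Info.prior_pos (I : Info) : 0 < I.prior := I.prior_mem.1

lemma Info.one_sub_prior_pos (I : Info) : 0 < 1 - I.prior := sub_pos.2 I.prior_mem.2

/-- The unconditional density of the signal. -/
noncomputable def Info.mix (I : Info) (s : ℝ) : ℝ :=
  I.prior * I.f 1 s + (1 - I.prior) * I.f 0 s

lemma Info.mix_nonneg (I : Info) (s : ℝ) : 0 ≤ I.mix s :=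
  add_nonneg (mul_nonneg I.prior_pos.le (I.f_nonneg _ _))
    (mul_nonneg I.one_sub_prior_pos.le (I.f_nonneg _ _))

lemma Info.ae_posterior (I : Info) : ∀ᵐ s ∂volume.restrict (Icc I.lo I.hi),
    s ∈ Icc I.lo I.hi ∧ I.prior * I.f 1 s = s * I.mix s ∧
      (1 - I.prior) * I.f 0 s = (1 - s) * I.mix s := by
  rw [ae_restrict_iff' measurableSet_Icc]
  filter_upwards [I.f_posterior] with s hs h
  have := hs h
  refine ⟨h, this.symm, ?_⟩
  unfold mix
  linarith

/-- A disclosure rate: the probability, as a function of the signal, that a sender is informed and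
discloses. It is bounded away from `1` because senders may be uninformed. -/
structure IsRate (I : Info) (d : ℝ → ℝ) : Prop where
  measurable : Measurable d
  nonneg : ∀ s ∈ Icc I.lo I.hi, 0 ≤ d s
  bound : ∃ r < 1, ∀ s ∈ Icc I.lo I.hi, d s ≤ r

/-- Probability in state `ω` that a sender with disclosure rate `d` stays silent. -/
noncomputable def silence (I : Info) (d : ℝ → ℝ) (ω : Fin 2) : ℝ :=
  1 - ∫ s in Icc I.lo I.hi, d s * I.f ω s

/-- Belief after the silence of a sender with disclosure rate `d`, the other sender's message being
ignored. -/
noncomputable def silenceBelief (I : Info) (d : ℝ → ℝ) : ℝ :=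
  I.prior * silence I d 1 / (I.prior * silence I d 1 + (1 - I.prior) * silence I d 0)

variable {I : Info} {d d' : ℝ → ℝ}

lemma IsRate.lt_one (h : IsRate I d) : ∀ s ∈ Icc I.lo I.hi, d s ≤ 1 := by
  obtain ⟨r, hr, h'⟩ := h.bound
  exact fun s hs => (h' s hs).trans hr.le

lemma IsRate.ae_mem (h : IsRate I d) :
    ∀ᵐ s ∂volume.restrict (Icc I.lo I.hi), 0 ≤ d s ∧ d s ≤ 1 := by
  rw [ae_restrict_iff' measurableSet_Icc]
  exact .of_forall fun s hs => ⟨h.nonneg s hs, h.lt_one s hs⟩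

lemma isRate_const (I : Info) {r : ℝ} (h0 : 0 ≤ r) (h1 : r < 1) : IsRate I (fun _ => r) :=
  ⟨measurable_const, fun _ _ => h0, r, h1, fun _ _ => le_rfl⟩

/-- Weighting an integrable function by a disclosure rate keeps it integrable. -/
lemma IsRate.integrable_mul (h : IsRate I d) {g : ℝ → ℝ} (hg : IntegrableOn g (Icc I.lo I.hi)) :
    IntegrableOn (fun s => d s * g s) (Icc I.lo I.hi) := by
  refine Integrable.bdd_mul (c := 1) hg h.measurable.aestronglyMeasurable ?_
  filter_upwards [h.ae_mem] with s hs
  rw [Real.norm_eq_abs, abs_le]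
  constructor <;> linarith [hs.1, hs.2]

lemma IsRate.integrable (h : IsRate I d) (ω : Fin 2) :
    IntegrableOn (fun s => d s * I.f ω s) (Icc I.lo I.hi) :=
  h.integrable_mul (I.integrableOn_f ω)

lemma silence_pos (h : IsRate I d) (ω : Fin 2) : 0 < silence I d ω := by
  obtain ⟨r, hr, h'⟩ := h.bound
  have : ∫ s in Icc I.lo I.hi, d s * I.f ω s ≤ ∫ s in Icc I.lo I.hi, r * I.f ω s :=
    setIntegral_mono_on (h.integrable ω) ((I.integrableOn_f ω).const_mul r) measurableSet_Icc
      fun s hs => mul_le_mul_of_nonneg_right (h' s hs) (I.f_nonneg _ _)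
  rw [integral_const_mul, I.f_total] at this
  unfold silence
  linarith

lemma silence_le_one (h : IsRate I d) (ω : Fin 2) : silence I d ω ≤ 1 := by
  have : 0 ≤ ∫ s in Icc I.lo I.hi, d s * I.f ω s :=
    setIntegral_nonneg measurableSet_Icc fun s hs => mul_nonneg (h.nonneg s hs) (I.f_nonneg _ _)
  unfold silence
  linarith

lemma silence_const (I : Info) (r : ℝ) (ω : Fin 2) : silence I (fun _ => r) ω = 1 - r := by
  unfold silence
  rw [integral_const_mul, I.f_total, mul_one]

lemma silence_sub (h : IsRate I d) (h' : IsRate I d') (ω : Fin 2) :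
    silence I d ω - silence I d' ω = ∫ s in Icc I.lo I.hi, (d' s - d s) * I.f ω s := by
  simp only [sub_mul]
  rw [integral_sub (h'.integrable ω) (h.integrable ω)]
  unfold silence
  ring

lemma silenceBelief_mem (h : IsRate I d) : silenceBelief I d ∈ Ioo (0 : ℝ) 1 := by
  have h1 := mul_pos I.prior_pos (silence_pos h 1)
  have h0 := mul_pos I.one_sub_prior_pos (silence_pos h 0)
  unfold silenceBelief
  exact ⟨by positivity, (div_lt_one (by positivity)).2 (by linarith)⟩

lemma silence_congr (h : d =ᵐ[volume.restrict (Icc I.lo I.hi)] d') (ω : Fin 2) :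
    silence I d ω = silence I d' ω := by
  unfold silence
  congr 1
  refine integral_congr_ae ?_
  filter_upwards [h] with s hs
  rw [hs]

lemma silenceBelief_congr (h : d =ᵐ[volume.restrict (Icc I.lo I.hi)] d') :
    silenceBelief I d = silenceBelief I d' := by
  simp only [silenceBelief, silence_congr h]

/-! ### Residual uncertainty -/

/-- `η (1 - η) psi η x y` is the product of the two posterior masses, divided by their sum, of a
message with likelihoods `x`, `y` in states `1`, `0` when the prior is `η`. -/
noncomputable def psi (η x y : ℝ) : ℝ := x * y / (η * x + (1 - η) * y)

lemma psi_nonneg {η x y : ℝ} (h0 : 0 < η) (h1 : η < 1) (hx : 0 ≤ x) (hy : 0 ≤ y) :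
    0 ≤ psi η x y := by
  have := sub_pos.2 h1
  unfold psi
  positivity

lemma psi_self {η x : ℝ} : psi η x x = x := by
  unfold psi
  have : η * x + (1 - η) * x = x := by ring
  rw [this, mul_self_div_self]

/-- `psi η` is concave and homogeneous, hence below its tangent at any `(x₀, y₀)`. -/
lemma psi_le_tangent {η x y x₀ y₀ : ℝ} (h0 : 0 < η) (h1 : η < 1) (hx : 0 ≤ x) (hy : 0 ≤ y)
    (hx₀ : 0 < x₀) (hy₀ : 0 < y₀) :
    psi η x y ≤ (1 - η) * y₀ ^ 2 / (η * x₀ + (1 - η) * y₀) ^ 2 * x +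
      η * x₀ ^ 2 / (η * x₀ + (1 - η) * y₀) ^ 2 * y := by
  have h1' := sub_pos.2 h1
  rcases hx.eq_or_lt with rfl | hx
  · simp only [psi, zero_mul, zero_div, mul_zero, zero_add]
    positivity
  have hD : 0 < η * x + (1 - η) * y := by positivity
  have hD₀ : 0 < η * x₀ + (1 - η) * y₀ := by positivity
  have : (1 - η) * y₀ ^ 2 / (η * x₀ + (1 - η) * y₀) ^ 2 * x +
      η * x₀ ^ 2 / (η * x₀ + (1 - η) * y₀) ^ 2 * y - psi η x y =
      η * (1 - η) * (y₀ * x - x₀ * y) ^ 2 /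
        ((η * x₀ + (1 - η) * y₀) ^ 2 * (η * x + (1 - η) * y)) := by
    unfold psi
    field_simp
    ring
  have h2 : 0 ≤ η * (1 - η) * (y₀ * x - x₀ * y) ^ 2 /
        ((η * x₀ + (1 - η) * y₀) ^ 2 * (η * x + (1 - η) * y)) := by positivity
  linarith

lemma psi_eq_tangent {η x₀ y₀ : ℝ} (h0 : 0 < η) (h1 : η < 1) (hx₀ : 0 < x₀) (hy₀ : 0 < y₀) :
    (1 - η) * y₀ ^ 2 / (η * x₀ + (1 - η) * y₀) ^ 2 * x₀ +
      η * x₀ ^ 2 / (η * x₀ + (1 - η) * y₀) ^ 2 * y₀ = psi η x₀ y₀ := by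
  have h1' := sub_pos.2 h1
  have hD₀ : 0 < η * x₀ + (1 - η) * y₀ := by positivity
  unfold psi
  field_simp
  ring

lemma psi_le {η x y : ℝ} (h0 : 0 < η) (h1 : η < 1) (hx : 0 ≤ x) (hy : 0 ≤ y) :
    psi η x y ≤ (1 - η) * x + η * y := by
  simpa using psi_le_tangent h0 h1 hx hy one_pos one_pos

/-- `(s - η) psi η x y` is `s x` less the product of the probability `s x + (1 - s) y` of the
message under the belief `s` and the posterior after it, which is increasing in the prior `η`. -/
lemma sub_mul_psi_anti {s η η' x y : ℝ} (hs : s ∈ Icc (0 : ℝ) 1) (h0 : 0 < η) (h : η ≤ η')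
    (h1 : η' < 1) (hx : 0 ≤ x) (hy : 0 ≤ y) :
    (s - η') * psi η' x y ≤ (s - η) * psi η x y := by
  have h1' := sub_pos.2 h1
  have h1'' := sub_pos.2 (h.trans_lt h1)
  rcases hx.eq_or_lt with rfl | hx
  · simp [psi]
  rcases hy.eq_or_lt with rfl | hy
  · simp [psi]
  have h0' : 0 < η' := h0.trans_le h
  have hD : 0 < η * x + (1 - η) * y := by positivity
  have hD' : 0 < η' * x + (1 - η') * y := by positivity
  have : (s - η) * psi η x y - (s - η') * psi η' x y =
      (x * y * (η' - η) * (s * x + (1 - s) * y)) /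
        ((η * x + (1 - η) * y) * (η' * x + (1 - η') * y)) := by
    unfold psi
    field_simp
    ring
  have h2 : 0 ≤ (x * y * (η' - η) * (s * x + (1 - s) * y)) /
        ((η * x + (1 - η) * y) * (η' * x + (1 - η') * y)) := by
    have := sub_nonneg.2 h
    have := sub_nonneg.2 hs.2
    have := hs.1
    positivity
  linarith

/-- `η (1 - η) residual I d η` is the expected posterior variance of the state when a prior `η` is
updated by the message of a sender with disclosure rate `d`. So `residual` is `1` for an
uninformative sender and would be `0` for a fully revealing one. -/
noncomputable def residual (I : Info) (d : ℝ → ℝ) (η : ℝ) : ℝ :=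
  (∫ s in Icc I.lo I.hi, d s * psi η (I.f 1 s) (I.f 0 s)) +
    psi η (silence I d 1) (silence I d 0)

lemma measurable_psi_f (I : Info) (η : ℝ) : Measurable fun s => psi η (I.f 1 s) (I.f 0 s) := by
  have := I.f_measurable 0
  have := I.f_measurable 1
  unfold psi
  fun_prop

lemma integrableOn_psi_f (I : Info) {η : ℝ} (h0 : 0 < η) (h1 : η < 1) :
    IntegrableOn (fun s => psi η (I.f 1 s) (I.f 0 s)) (Icc I.lo I.hi) := by
  refine Integrable.mono' (((I.integrableOn_f 1).const_mul (1 - η)).add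
    ((I.integrableOn_f 0).const_mul η)) (measurable_psi_f I η).aestronglyMeasurable
    (.of_forall fun s => ?_)
  rw [Real.norm_eq_abs, abs_of_nonneg (psi_nonneg h0 h1 (I.f_nonneg _ _) (I.f_nonneg _ _))]
  exact psi_le h0 h1 (I.f_nonneg _ _) (I.f_nonneg _ _)

lemma residual_congr (h : d =ᵐ[volume.restrict (Icc I.lo I.hi)] d') (η : ℝ) :
    residual I d η = residual I d' η := by
  simp only [residual, silence_congr h]
  congr 1
  refine integral_congr_ae ?_
  filter_upwards [h] with s hs
  rw [hs]

/-- A sender who discloses more leaves less residual uncertainty: the messages that he separates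
from silence were pooled by the concave `psi η`. -/
lemma residual_anti (h : IsRate I d) (h' : IsRate I d')
    (hle : d ≤ᵐ[volume.restrict (Icc I.lo I.hi)] d') {η : ℝ} (h0 : 0 < η) (h1 : η < 1) :
    residual I d' η ≤ residual I d η := by
  set x₀ := silence I d 1 with hx₀
  set y₀ := silence I d 0 with hy₀
  have px := silence_pos h 1
  have py := silence_pos h 0
  set a := (1 - η) * y₀ ^ 2 / (η * x₀ + (1 - η) * y₀) ^ 2
  set b := η * x₀ ^ 2 / (η * x₀ + (1 - η) * y₀) ^ 2
  have hψ := integrableOn_psi_f I h0 h1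
  have e1 : (∫ s in Icc I.lo I.hi, d' s * psi η (I.f 1 s) (I.f 0 s)) -
      ∫ s in Icc I.lo I.hi, d s * psi η (I.f 1 s) (I.f 0 s) =
      ∫ s in Icc I.lo I.hi, (d' s - d s) * psi η (I.f 1 s) (I.f 0 s) := by
    simp only [sub_mul]
    rw [integral_sub (h'.integrable_mul hψ) (h.integrable_mul hψ)]
  have hi (ω : Fin 2) : IntegrableOn (fun s => (d' s - d s) * I.f ω s) (Icc I.lo I.hi) := by
    simp only [sub_mul]
    exact (h'.integrable ω).sub (h.integrable ω)
  have e2 : ∫ s in Icc I.lo I.hi, (d' s - d s) * psi η (I.f 1 s) (I.f 0 s) ≤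
      ∫ s in Icc I.lo I.hi, (a * ((d' s - d s) * I.f 1 s) + b * ((d' s - d s) * I.f 0 s)) := by
    refine integral_mono_ae ?_ (((hi 1).const_mul a).add ((hi 0).const_mul b)) ?_
    · simp only [sub_mul]
      exact (h'.integrable_mul hψ).sub (h.integrable_mul hψ)
    · filter_upwards [hle] with s hs
      have := mul_le_mul_of_nonneg_left
        (psi_le_tangent h0 h1 (I.f_nonneg 1 s) (I.f_nonneg 0 s) px py) (sub_nonneg.2 hs)
      calc _ ≤ _ := this
        _ = _ := by ring
  rw [integral_add ((hi 1).const_mul a) ((hi 0).const_mul b), integral_const_mul,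
    integral_const_mul, ← silence_sub h h', ← silence_sub h h'] at e2
  have e3 := psi_le_tangent h0 h1 (silence_pos h' 1).le (silence_pos h' 0).le px py
  have e4 := psi_eq_tangent h0 h1 px py
  unfold residual
  linarith

lemma residual_const (I : Info) (r η : ℝ) : residual I (fun _ => r) η =
    r * (∫ s in Icc I.lo I.hi, psi η (I.f 1 s) (I.f 0 s)) + (1 - r) := by
  simp only [residual, silence_const, psi_self, integral_const_mul]

lemma residual_le_one (h : IsRate I d) {η : ℝ} (h0 : 0 < η) (h1 : η < 1) :
    residual I d η ≤ 1 := by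
  have : (fun _ => (0 : ℝ)) ≤ᵐ[volume.restrict (Icc I.lo I.hi)] d := by
    filter_upwards [h.ae_mem] with s hs using hs.1
  have := residual_anti (isRate_const I le_rfl one_pos) h this h0 h1
  rw [residual_const] at this
  linarith

lemma psi_silence_le_residual (h : IsRate I d) {η : ℝ} (h0 : 0 < η) (h1 : η < 1) :
    psi η (silence I d 1) (silence I d 0) ≤ residual I d η := by
  have : 0 ≤ ∫ s in Icc I.lo I.hi, d s * psi η (I.f 1 s) (I.f 0 s) :=
    setIntegral_nonneg measurableSet_Icc fun s hs =>
      mul_nonneg (h.nonneg s hs) (psi_nonneg h0 h1 (I.f_nonneg _ _) (I.f_nonneg _ _))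
  unfold residual
  linarith

lemma one_sub_le_residual (h : IsRate I d) {r : ℝ} (hr : r < 1)
    (hd : ∀ s ∈ Icc I.lo I.hi, d s ≤ r) {η : ℝ} (h0 : 0 < η) (h1 : η < 1) :
    1 - r ≤ residual I d η := by
  have hr0 : 0 ≤ r := (h.nonneg _ ⟨le_rfl, I.lo_lt_hi.le⟩).trans (hd _ ⟨le_rfl, I.lo_lt_hi.le⟩)
  have : d ≤ᵐ[volume.restrict (Icc I.lo I.hi)] fun _ => r := by
    rw [Filter.EventuallyLE, ae_restrict_iff' measurableSet_Icc]
    exact .of_forall hd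
  have h2 := residual_anti h (isRate_const I hr0 hr) this h0 h1
  have h3 := psi_silence_le_residual (isRate_const I hr0 hr) h0 h1
  simp only [silence_const, psi_self] at h3
  linarith

lemma residual_pos (h : IsRate I d) {η : ℝ} (h0 : 0 < η) (h1 : η < 1) : 0 < residual I d η := by
  obtain ⟨r, hr, hd⟩ := h.bound
  linarith [one_sub_le_residual h hr hd h0 h1]

/-- With a higher prior of the decision maker, her expected posterior, as seen by a sender with
belief `s`, is higher. -/
lemma sub_mul_residual_anti (h : IsRate I d) {s η η' : ℝ} (hs : s ∈ Icc (0 : ℝ) 1) (h0 : 0 < η)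
    (hle : η ≤ η') (h1 : η' < 1) :
    (s - η') * residual I d η' ≤ (s - η) * residual I d η := by
  unfold residual
  rw [mul_add, mul_add, ← integral_const_mul, ← integral_const_mul]
  refine add_le_add ?_ (sub_mul_psi_anti hs h0 hle h1 (silence_pos h 1).le (silence_pos h 0).le)
  refine setIntegral_mono_on
    ((h.integrable_mul (integrableOn_psi_f I (h0.trans_le hle) h1)).const_mul _)
    ((h.integrable_mul (integrableOn_psi_f I h0 (hle.trans_lt h1))).const_mul _)
    measurableSet_Icc fun x hx => ?_
  have := mul_le_mul_of_nonneg_left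
    (sub_mul_psi_anti hs h0 hle h1 (I.f_nonneg 1 x) (I.f_nonneg 0 x)) (h.nonneg x hx)
  linarith

lemma continuousOn_psi {x y : ℝ} (hx : 0 ≤ x) (hy : 0 ≤ y) :
    ContinuousOn (fun η => psi η x y) (Ioo 0 1) := by
  rcases hx.eq_or_lt with rfl | hx
  · simp only [psi, zero_mul, zero_div]
    exact continuousOn_const
  unfold psi
  refine ContinuousOn.div (by fun_prop) (by fun_prop) fun η hη => ?_
  have := hη.1
  have := sub_pos.2 hη.2
  positivity

lemma continuousOn_residual (h : IsRate I d) : ContinuousOn (residual I d) (Ioo 0 1) := by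
  unfold residual
  refine ContinuousOn.add ?_ (continuousOn_psi (silence_pos h 1).le (silence_pos h 0).le)
  refine continuousOn_of_dominated (bound := fun s => I.f 1 s + I.f 0 s)
    (fun η _ => (h.measurable.mul (measurable_psi_f I η)).aestronglyMeasurable) (fun η hη => ?_)
    ((I.integrableOn_f 1).add (I.integrableOn_f 0)) (.of_forall fun s => ?_)
  · filter_upwards [h.ae_mem] with s hs
    have h1 := I.f_nonneg 1 s
    have h2 := I.f_nonneg 0 s
    have h3 := psi_nonneg hη.1 hη.2 h1 h2
    have h4 := psi_le hη.1 hη.2 h1 h2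
    rw [Real.norm_eq_abs, abs_of_nonneg (mul_nonneg hs.1 h3)]
    nlinarith [hη.1, hη.2, hs.1, hs.2]
  · exact continuousOn_const.mul (continuousOn_psi (I.f_nonneg _ _) (I.f_nonneg _ _))

end

section

/-! ### Payoffs -/

variable {I : Info} {p : Fin 2 → ℝ} {c : ℝ} {σ : Profile}

/-- The disclosure rate of sender `i` in the profile `σ`. -/
def rate (p : Fin 2 → ℝ) (σ : Profile) (i : Fin 2) (s : ℝ) : ℝ := p i * σ i s

lemma isRate_rate {i : Fin 2} (hp : p i ∈ Ioo (0 : ℝ) 1) (hm : Measurable (σ i))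
    (hσ : ∀ s ∈ Icc I.lo I.hi, σ i s ∈ Icc (0 : ℝ) 1) : IsRate I (rate p σ i) :=
  ⟨hm.const_mul _, fun s hs => mul_nonneg hp.1.le (hσ s hs).1, p i, hp.2,
    fun s hs => mul_le_of_le_one_right hp.1.le (hσ s hs).2⟩

lemma ndProb_eq_silence {i : Fin 2} (h : IsRate I (rate p σ i)) (ω : Fin 2) :
    ndProb I p σ i ω = silence I (rate p σ i) ω := by
  have h1 : p i * ∫ s in Icc I.lo I.hi, (1 - σ i s) * I.f ω s =
      ∫ s in Icc I.lo I.hi, (p i * I.f ω s - rate p σ i s * I.f ω s) := by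
    rw [← integral_const_mul]
    congr 1
    ext s
    unfold rate
    ring
  rw [integral_sub ((I.integrableOn_f ω).const_mul _) (h.integrable ω), integral_const_mul,
    I.f_total] at h1
  unfold ndProb silence
  linarith

/-- Posterior of state `1` when a prior `η` is updated by a message with likelihoods `x`, `y` in
states `1`, `0`. -/
noncomputable def post (η x y : ℝ) : ℝ := η * x / (η * x + (1 - η) * y)

lemma post_mem {η x y : ℝ} (hη : η ∈ Icc (0 : ℝ) 1) (hx : 0 ≤ x) (hy : 0 ≤ y) :
    post η x y ∈ Icc (0 : ℝ) 1 := by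
  have h1 := mul_nonneg hη.1 hx
  have h2 := mul_nonneg (sub_nonneg.2 hη.2) hy
  exact ⟨div_nonneg h1 (by linarith), div_le_one_of_le₀ (by linarith) (by linarith)⟩

lemma post_mul {η x y k : ℝ} (hk : k ≠ 0) : post η (k * x) (k * y) = post η x y := by
  unfold post
  rw [← mul_div_mul_left (η * x) _ hk]
  congr 1 <;> ring

/-- The probability of a message under the belief `s` of a sender times the decision maker's
posterior, when that sender's own message has moved her to the interim belief `η`. The first case
of `h` is his silence, and the second one is his disclosure of `s`. -/
lemma mul_post {s η x y : ℝ} (hs : s ∈ Icc (0 : ℝ) 1) (h : η ∈ Ioo (0 : ℝ) 1 ∨ η = s) (hx : 0 ≤ x)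
    (hy : 0 ≤ y) : (s * x + (1 - s) * y) * post η x y = s * x + (η - s) * psi η x y := by
  have h0 : η * x + (1 - η) * y = 0 → s * x = 0 := by
    intro h0
    rcases h with h | rfl
    · have h1 := mul_nonneg h.1.le hx
      have h2 := mul_nonneg (sub_pos.2 h.2).le hy
      have : η * x = 0 := by linarith
      rw [(mul_eq_zero.1 this).resolve_left h.1.ne', mul_zero]
    · have h1 := mul_nonneg hs.1 hx
      have h2 := mul_nonneg (sub_nonneg.2 hs.2) hy
      linarith
  unfold post psi
  by_cases hD : η * x + (1 - η) * y = 0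
  · rw [hD, h0 hD]
    simp
  · rw [mul_div_assoc', mul_div_assoc']
    rw [div_eq_iff hD, add_mul (s * x) ((η - s) * (x * y) / (η * x + (1 - η) * y)),
      div_mul_cancel₀ _ hD]
    ring

lemma lik_some_one (I : Info) (p : Fin 2 → ℝ) (σ : Profile) (i : Fin 2) (s : ℝ) :
    lik I p σ i 1 (some s) = s / I.prior := by
  simp [lik]

lemma lik_some_zero (I : Info) (p : Fin 2 → ℝ) (σ : Profile) (i : Fin 2) (s : ℝ) :
    lik I p σ i 0 (some s) = (1 - s) / (1 - I.prior) := by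
  simp [lik]

lemma belief_eq_post {i : Fin 2} {m m' : Option ℝ} {M η : ℝ} (hM : M ≠ 0)
    (h1 : I.prior * lik I p σ i 1 m = M * η)
    (h0 : (1 - I.prior) * lik I p σ i 0 m = M * (1 - η)) :
    belief I p σ (fun k => if k = i then m else m') =
      post η (lik I p σ i.rev 1 m') (lik I p σ i.rev 0 m') := by
  have e (ω : Fin 2) : ∏ k, lik I p σ k ω (if k = i then m else m') =
      lik I p σ i ω m * lik I p σ i.rev ω m' := by
    fin_cases i
    · simp [Fin.prod_univ_two]
    · simp [Fin.prod_univ_two, mul_comm]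
  unfold belief
  rw [e, e, ← mul_assoc, ← mul_assoc, h1, h0, mul_assoc, mul_assoc, ← mul_add,
    mul_div_mul_left _ _ hM, post]

lemma Info.mem_unit (I : Info) {s : ℝ} (hs : s ∈ Icc I.lo I.hi) : s ∈ Icc (0 : ℝ) 1 :=
  ⟨I.lo_nonneg.trans hs.1, hs.2.trans I.hi_le_one⟩

lemma Info.f_eq (I : Info) : ∀ᵐ s ∂volume.restrict (Icc I.lo I.hi), s ∈ Icc I.lo I.hi ∧
    I.f 1 s = I.mix s * (s / I.prior) ∧ I.f 0 s = I.mix s * ((1 - s) / (1 - I.prior)) := by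
  have := I.prior_pos.ne'
  have := I.one_sub_prior_pos.ne'
  filter_upwards [I.ae_posterior] with s hs
  refine ⟨hs.1, ?_, ?_⟩
  · field_simp
    linarith [hs.2.1]
  · field_simp
    linarith [hs.2.2]

/-- The decision maker's belief, as expected by a sender with belief `s` whose own message has moved
her from the prior to `η`. -/
lemma expBelief_eq {i : Fin 2} {m : Option ℝ} {s M η : ℝ} (h : IsRate I (rate p σ i.rev))
    (hs : s ∈ Icc (0 : ℝ) 1) (hη : η ∈ Ioo (0 : ℝ) 1 ∨ η = s) (hM : M ≠ 0)
    (h1 : I.prior * lik I p σ i 1 m = M * η)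
    (h0 : (1 - I.prior) * lik I p σ i 0 m = M * (1 - η)) :
    s * expBelief I p σ i 1 m + (1 - s) * expBelief I p σ i 0 m =
      s + (η - s) * residual I (rate p σ i.rev) η := by
  have hη' : η ∈ Icc (0 : ℝ) 1 := by
    rcases hη with h | rfl
    exacts [⟨h.1.le, h.2.le⟩, hs]
  have hπ := I.prior_pos
  have hπ' := I.one_sub_prior_pos
  set d := rate p σ i.rev with hd
  set B : ℝ → ℝ := fun x => post η (x / I.prior) ((1 - x) / (1 - I.prior)) with hB
  set Q := post η (silence I d 1) (silence I d 0)
  have hBm : Measurable B := by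
    simp only [hB, post]
    fun_prop
  have hE (ω : Fin 2) : expBelief I p σ i ω m =
      (∫ x in Icc I.lo I.hi, d x * (I.f ω x * B x)) + silence I d ω * Q := by
    simp only [← mul_assoc]
    simp only [expBelief, msgExp, belief_eq_post hM h1 h0, lik_some_one, lik_some_zero]
    simp only [lik, ndProb_eq_silence h]
    rfl
  have hBi (ω : Fin 2) : IntegrableOn (fun x => I.f ω x * B x) (Icc I.lo I.hi) := by
    refine Integrable.mul_bdd (c := 1) (I.integrableOn_f ω) hBm.aestronglyMeasurable ?_
    rw [ae_restrict_iff' measurableSet_Icc]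
    refine .of_forall fun x hx => ?_
    have hx' := I.mem_unit hx
    have := post_mem hη' (div_nonneg hx'.1 hπ.le) (div_nonneg (sub_nonneg.2 hx'.2) hπ'.le)
    rw [Real.norm_eq_abs, abs_of_nonneg this.1]
    exact this.2
  have hψ : IntegrableOn (fun x => (η - s) * psi η (I.f 1 x) (I.f 0 x)) (Icc I.lo I.hi) := by
    rcases hη with hη | rfl
    · exact (integrableOn_psi_f I hη.1 hη.2).const_mul _
    · simp
  have key : (fun x => s * (d x * (I.f 1 x * B x)) + (1 - s) * (d x * (I.f 0 x * B x)))
      =ᵐ[volume.restrict (Icc I.lo I.hi)]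
      fun x => s * (d x * I.f 1 x) + d x * ((η - s) * psi η (I.f 1 x) (I.f 0 x)) := by
    filter_upwards [I.f_eq] with x hx
    have : (s * I.f 1 x + (1 - s) * I.f 0 x) * B x =
        s * I.f 1 x + (η - s) * psi η (I.f 1 x) (I.f 0 x) := by
      rw [← mul_post hs hη (I.f_nonneg _ _) (I.f_nonneg _ _)]
      rcases eq_or_ne (I.mix x) 0 with h0 | h0
      · simp [hx.2.1, hx.2.2, h0]
      · rw [hx.2.1, hx.2.2, post_mul h0]
    linear_combination d x * this
  have e := integral_congr_ae key
  rw [integral_add ((h.integrable_mul (hBi 1)).const_mul s)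
      ((h.integrable_mul (hBi 0)).const_mul _),
    integral_add ((h.integrable 1).const_mul s) (h.integrable_mul hψ)] at e
  simp only [integral_const_mul, mul_left_comm (d _) (η - s)] at e
  have e2 := mul_post hs hη (silence_pos h 1).le (silence_pos h 0).le
  have e3 : ∫ x in Icc I.lo I.hi, d x * I.f 1 x = 1 - silence I d 1 := by
    unfold silence
    ring
  rw [e3] at e
  rw [hE, hE, residual]
  linear_combination e + e2

lemma payoff_some {i : Fin 2} {s : ℝ} (h : IsRate I (rate p σ i.rev)) (hs : s ∈ Icc (0 : ℝ) 1) :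
    payoff I p c σ i s (some s) = s - c := by
  have := I.prior_pos.ne'
  have := I.one_sub_prior_pos.ne'
  have := expBelief_eq (m := some s) (i := i) (M := 1) (η := s) h hs (.inr rfl) one_ne_zero
    (by rw [lik_some_one]; field_simp) (by rw [lik_some_zero]; field_simp)
  simp [payoff, this]

lemma payoff_none {i : Fin 2} {s : ℝ} (h : ∀ k, IsRate I (rate p σ k)) (hs : s ∈ Icc (0 : ℝ) 1) :
    payoff I p c σ i s none = s + (silenceBelief I (rate p σ i) - s) *
      residual I (rate p σ i.rev) (silenceBelief I (rate p σ i)) := by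
  have h1 := mul_pos I.prior_pos (silence_pos (h i) 1)
  have h0 := mul_pos I.one_sub_prior_pos (silence_pos (h i) 0)
  have hM := (add_pos h1 h0).ne'
  have := expBelief_eq (m := none) (i := i) (h i.rev) hs (.inl (silenceBelief_mem (h i))) hM
    (by simp only [lik, ndProb_eq_silence (h i), silenceBelief]; field_simp)
    (by simp only [lik, ndProb_eq_silence (h i), silenceBelief]; field_simp; ring)
  simp [payoff, this]

/-! ### Equilibria are threshold equilibria -/

/-- Gain of a sender with signal `s` from disclosing it at no cost, if his disclosure rate is
believed to be `d` and that of the other sender is `d'`. -/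
noncomputable def advantage (I : Info) (d d' : ℝ → ℝ) (s : ℝ) : ℝ :=
  (s - silenceBelief I d) * residual I d' (silenceBelief I d)

lemma advantage_strictMono {d d' : ℝ → ℝ} (h : IsRate I d) (h' : IsRate I d') :
    StrictMono (advantage I d d') := by
  have hη := silenceBelief_mem h
  intro s s' hs
  exact mul_lt_mul_of_pos_right (by linarith) (residual_pos h' hη.1 hη.2)

lemma IsEquilibrium.isRate (hp : ∀ k, p k ∈ Ioo (0 : ℝ) 1) (h : IsEquilibrium I p c σ) (k : Fin 2) :
    IsRate I (rate p σ k) :=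
  isRate_rate (hp k) (h k).1 fun s hs => ((h k).2 s hs).1

/-- A type discloses if his advantage exceeds the cost and conceals if it falls short of it. -/
lemma isEquilibrium_iff (hp : ∀ k, p k ∈ Ioo (0 : ℝ) 1) :
    IsEquilibrium I p c σ ↔ (∀ k, Measurable (σ k) ∧ ∀ s ∈ Icc I.lo I.hi, σ k s ∈ Icc (0 : ℝ) 1) ∧
      ∀ k, ∀ s ∈ Icc I.lo I.hi,
        (c < advantage I (rate p σ k) (rate p σ k.rev) s → σ k s = 1) ∧
        (advantage I (rate p σ k) (rate p σ k.rev) s < c → σ k s = 0) := by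
  have main (hσ : ∀ k, Measurable (σ k) ∧ ∀ s ∈ Icc I.lo I.hi, σ k s ∈ Icc (0 : ℝ) 1) (k : Fin 2)
      (s : ℝ) (hs : s ∈ Icc I.lo I.hi) : payoff I p c σ k s (some s) - payoff I p c σ k s none =
        advantage I (rate p σ k) (rate p σ k.rev) s - c := by
    have h (k) := isRate_rate (hp k) (hσ k).1 (hσ k).2
    rw [payoff_some (h _) (I.mem_unit hs), payoff_none h (I.mem_unit hs), advantage]
    ring
  constructor
  · intro h
    have hσ (k : Fin 2) : Measurable (σ k) ∧ ∀ s ∈ Icc I.lo I.hi, σ k s ∈ Icc (0 : ℝ) 1 :=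
      ⟨(h k).1, fun s hs => ((h k).2 s hs).1⟩
    refine ⟨hσ, fun k s hs => ?_⟩
    have e := main hσ k s hs
    obtain ⟨hm, ho⟩ := (h k).2 s hs
    constructor
    · intro hc
      have := ho 1 (by simp)
      refine le_antisymm hm.2 ?_
      by_contra! hlt
      nlinarith
    · intro hc
      have := ho 0 (by simp)
      refine le_antisymm ?_ hm.1
      by_contra! hlt
      nlinarith
  · rintro ⟨hσ, h⟩ k
    refine ⟨(hσ k).1, fun s hs => ⟨(hσ k).2 s hs, fun r hr => ?_⟩⟩
    have e := main hσ k s hs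
    obtain ⟨h1, h2⟩ := h k s hs
    rcases lt_trichotomy c (advantage I (rate p σ k) (rate p σ k.rev) s) with hc | hc | hc
    · rw [h1 hc]
      nlinarith [hr.2]
    · have : payoff I p c σ k s (some s) = payoff I p c σ k s none := by linarith
      rw [this]
      linarith
    · rw [h2 hc]
      nlinarith [hr.1]

/-- Thresholds of a strategy profile are unique. -/
lemma HasThresholds.unique {t t' : Fin 2 → ℝ} (h : HasThresholds I σ t)
    (h' : HasThresholds I σ t') : t = t' := by
  have key {t t' : Fin 2 → ℝ} (h : HasThresholds I σ t) (h' : HasThresholds I σ t') (k : Fin 2) :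
      t k ≤ t' k := by
    by_contra! hlt
    obtain ⟨s, hs, hs'⟩ := exists_between hlt
    have hm : s ∈ Icc I.lo I.hi := ⟨(h' k).1.1.trans hs.le, hs'.le.trans (h k).1.2⟩
    linarith [((h k).2 s hm).2 hs', ((h' k).2 s hm).1 hs]
  exact funext fun k => le_antisymm (key h h' k) (key h' h k)

/-- Disclosure rate of a sender who is informed with probability `r` and has threshold `t`. -/
noncomputable def cutoff (r t : ℝ) (s : ℝ) : ℝ := if t < s then r else 0

lemma isRate_cutoff (I : Info) {r : ℝ} (hr : r ∈ Ioo (0 : ℝ) 1) (t : ℝ) :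
    IsRate I (cutoff r t) := by
  refine ⟨Measurable.ite measurableSet_Ioi measurable_const measurable_const, fun s _ => ?_, r,
    hr.2, fun s _ => ?_⟩ <;> unfold cutoff <;> split_ifs <;> linarith [hr.1]

lemma HasThresholds.rate_ae_eq {t : Fin 2 → ℝ} (h : HasThresholds I σ t) (k : Fin 2) :
    rate p σ k =ᵐ[volume.restrict (Icc I.lo I.hi)] cutoff (p k) (t k) := by
  have hne : ∀ᵐ s ∂volume.restrict (Icc I.lo I.hi), s ≠ t k :=
    Measure.ae_ne _ _
  filter_upwards [hne, ae_restrict_mem measurableSet_Icc] with s hs hm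
  unfold rate cutoff
  rcases lt_or_gt_of_ne hs with hs | hs
  · rw [((h k).2 s hm).2 hs, if_neg hs.not_gt, mul_zero]
  · rw [((h k).2 s hm).1 hs, if_pos hs, mul_one]

/-- Gain from costless disclosure of the threshold type of sender `k` if both senders use the
thresholds `t`. -/
noncomputable def gap (I : Info) (p t : Fin 2 → ℝ) (k : Fin 2) : ℝ :=
  advantage I (cutoff (p k) (t k)) (cutoff (p k.rev) (t k.rev)) (t k)

lemma HasThresholds.advantage_eq {t : Fin 2 → ℝ} (h : HasThresholds I σ t) (k : Fin 2) (s : ℝ) :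
    advantage I (rate p σ k) (rate p σ k.rev) s =
      advantage I (cutoff (p k) (t k)) (cutoff (p k.rev) (t k.rev)) s := by
  simp only [advantage, silenceBelief_congr (h.rate_ae_eq k), residual_congr (h.rate_ae_eq k.rev)]

/-- Every equilibrium is in threshold strategies, because the advantage of disclosure is increasing
in the signal. -/
lemma IsEquilibrium.exists_hasThresholds (hp : ∀ k, p k ∈ Ioo (0 : ℝ) 1)
    (h : IsEquilibrium I p c σ) : ∃ t, HasThresholds I σ t := by
  have hr := h.isRate hp
  have h2 := ((isEquilibrium_iff hp).1 h).2
  have key (k : Fin 2) : ∃ z, ∀ s ∈ Icc I.lo I.hi, (z < s → σ k s = 1) ∧ (s < z → σ k s = 0) := by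
    have hη := silenceBelief_mem (hr k)
    have hpos := residual_pos (hr k.rev) hη.1 hη.2
    refine ⟨silenceBelief I (rate p σ k) +
      c / residual I (rate p σ k.rev) (silenceBelief I (rate p σ k)), fun s hs => ⟨fun hz => ?_,
      fun hz => ?_⟩⟩
    · refine (h2 k s hs).1 ?_
      rw [← lt_sub_iff_add_lt', div_lt_iff₀ hpos] at hz
      exact hz
    · refine (h2 k s hs).2 ?_
      rw [← sub_lt_iff_lt_add', lt_div_iff₀ hpos] at hz
      exact hz
  choose z hz using key
  have hlo := I.lo_lt_hi.le
  refine ⟨fun k => max I.lo (min (z k) I.hi), fun k => ⟨⟨le_max_left _ _, max_le hlo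
    (min_le_right _ _)⟩, fun s hs => ⟨fun h => (hz k s hs).1 ?_, fun h => (hz k s hs).2 ?_⟩⟩⟩
  · rcases min_lt_iff.1 ((le_max_right _ _).trans_lt h) with h | h
    · exact h
    · exact absurd hs.2 h.not_ge
  · rcases lt_max_iff.1 h with h | h
    · exact absurd hs.1 h.not_ge
    · exact (lt_min_iff.1 h).1

/-- A pair of thresholds is an equilibrium if and only if each threshold type is indifferent, up to
corner solutions. -/
lemma isEqThresholds_iff (hp : ∀ k, p k ∈ Ioo (0 : ℝ) 1) {t : Fin 2 → ℝ} :
    IsEqThresholds I p c t ↔ ∀ k, t k ∈ Icc I.lo I.hi ∧ (t k = I.lo ∨ gap I p t k ≤ c) ∧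
      (t k = I.hi ∨ c ≤ gap I p t k) := by
  have hmono (k : Fin 2) : StrictMono (advantage I (cutoff (p k) (t k))
      (cutoff (p k.rev) (t k.rev))) :=
    advantage_strictMono (isRate_cutoff I (hp _) _) (isRate_cutoff I (hp _) _)
  have hcont (k : Fin 2) : Continuous (advantage I (cutoff (p k) (t k))
      (cutoff (p k.rev) (t k.rev))) := by
    unfold advantage
    fun_prop
  constructor
  · rintro ⟨σ, hσ, ht⟩ k
    have h2 := ((isEquilibrium_iff hp).1 hσ).2 k
    simp only [ht.advantage_eq] at h2
    refine ⟨(ht k).1, ?_, ?_⟩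
    · by_contra! h
      have hlt := lt_of_le_of_ne (ht k).1.1 h.1.symm
      obtain ⟨s, hs, hs'⟩ := ((((hcont k).tendsto (t k)).eventually (lt_mem_nhds h.2)).filter_mono
        nhdsWithin_le_nhds |>.and (Ioo_mem_nhdsLT hlt)).exists
      have hm : s ∈ Icc I.lo I.hi := ⟨hs'.1.le, hs'.2.le.trans (ht k).1.2⟩
      linarith [(h2 s hm).1 hs, ((ht k).2 s hm).2 hs'.2]
    · by_contra! h
      have hlt := lt_of_le_of_ne (ht k).1.2 h.1
      obtain ⟨s, hs, hs'⟩ := ((((hcont k).tendsto (t k)).eventually (gt_mem_nhds h.2)).filter_mono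
        nhdsWithin_le_nhds |>.and (Ioo_mem_nhdsGT hlt)).exists
      have hm : s ∈ Icc I.lo I.hi := ⟨(ht k).1.1.trans hs'.1.le, hs'.2.le⟩
      linarith [(h2 s hm).2 hs, ((ht k).2 s hm).1 hs'.1]
  · intro h
    set σ : Profile := fun k s => if c ≤ advantage I (cutoff (p k) (t k))
      (cutoff (p k.rev) (t k.rev)) s then 1 else 0 with hσ
    have ht : HasThresholds I σ t := by
      refine fun k => ⟨(h k).1, fun s hs => ⟨fun hts => ?_, fun hst => ?_⟩⟩
      · refine if_pos ?_
        rcases (h k).2.2 with h' | h'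
        · linarith [hs.2]
        · exact h'.trans (hmono k hts).le
      · refine if_neg (not_le.2 ?_)
        rcases (h k).2.1 with h' | h'
        · linarith [hs.1]
        · exact (hmono k hst).trans_le h'
    refine ⟨σ, (isEquilibrium_iff hp).2 ⟨fun k => ⟨?_, fun s _ => ?_⟩, fun k s hs => ?_⟩, ht⟩
    · exact Measurable.ite (measurableSet_le measurable_const (hcont k).measurable)
        measurable_const measurable_const
    · simp only [hσ]
      split_ifs <;> simp
    · rw [ht.advantage_eq]
      exact ⟨fun h => if_pos h.le, fun h => if_neg h.not_ge⟩

end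

section

/-! ### Extremal equilibria -/

lemma forall_rev_iff {P : Fin 2 → Prop} (k : Fin 2) : (∀ j, P j) ↔ P k ∧ P k.rev := by
  fin_cases k <;> simp [Fin.forall_fin_two, and_comm]

/-- A Tarski-type fixed point result: the componentwise supremum of all points at which neither
coordinate would rather fall is itself such a point, and no coordinate would rather rise there.
Only the sign of `H` has to be monotone, and `H k` has to be continuous only in the coordinate `k`,
its first argument. -/
lemma exists_greatest_balanced {a b : Fin 2 → ℝ} (hab : ∀ k, a k ≤ b k) (H : Fin 2 → ℝ → ℝ → ℝ)
    (hcont : ∀ k y, Continuous fun x => H k x y)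
    (hmono : ∀ k x y y', y ≤ y' → H k x y ≤ 0 → H k x y' ≤ 0) :
    ∃ s : Fin 2 → ℝ, (∀ k, s k ∈ Icc (a k) (b k) ∧ (s k = a k ∨ H k (s k) (s k.rev) ≤ 0) ∧
      (s k = b k ∨ 0 ≤ H k (s k) (s k.rev))) ∧
      ∀ x : Fin 2 → ℝ, (∀ k, x k ∈ Icc (a k) (b k) ∧ (x k = a k ∨ H k (x k) (x k.rev) ≤ 0)) →
        ∀ k, x k ≤ s k := by
  set D : Set (Fin 2 → ℝ) :=
    {x | ∀ k, x k ∈ Icc (a k) (b k) ∧ (x k = a k ∨ H k (x k) (x k.rev) ≤ 0)} with hD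
  have haD : a ∈ D := fun k => ⟨⟨le_rfl, hab k⟩, .inl rfl⟩
  have hbdd (k : Fin 2) : BddAbove ((fun x : Fin 2 → ℝ => x k) '' D) := by
    refine ⟨b k, ?_⟩
    rintro _ ⟨x, hx, rfl⟩
    exact (hx k).1.2
  set s : Fin 2 → ℝ := fun k => sSup ((fun x : Fin 2 → ℝ => x k) '' D) with hs
  have hle (x) (hx : x ∈ D) (k : Fin 2) : x k ≤ s k := le_csSup (hbdd k) ⟨x, hx, rfl⟩
  have hsD : s ∈ D := by
    intro k
    have hcl : IsClosed (Icc (a k) (b k) ∩ ({a k} ∪ {x | H k x (s k.rev) ≤ 0})) :=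
      isClosed_Icc.inter (isClosed_singleton.union (isClosed_le (hcont k _) continuous_const))
    have hsub : (fun x : Fin 2 → ℝ => x k) '' D ⊆
        Icc (a k) (b k) ∩ ({a k} ∪ {x | H k x (s k.rev) ≤ 0}) := by
      rintro _ ⟨x, hx, rfl⟩
      exact ⟨(hx k).1, (hx k).2.imp id (hmono k _ _ _ (hle x hx k.rev))⟩
    exact closure_minimal hsub hcl (csSup_mem_closure ⟨a k, a, haD, rfl⟩ (hbdd k))
  refine ⟨s, fun k => ⟨(hsD k).1, (hsD k).2, ?_⟩, hle⟩
  by_contra! h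
  have hlt : s k < b k := lt_of_le_of_ne (hsD k).1.2 h.1
  obtain ⟨y, hy, hy'⟩ := ((((hcont k (s k.rev)).tendsto (s k)).eventually
    (gt_mem_nhds h.2)).filter_mono nhdsWithin_le_nhds |>.and (Ioo_mem_nhdsGT hlt)).exists
  have hne : k.rev ≠ k := by fin_cases k <;> simp
  have hx : Function.update s k y ∈ D := by
    refine (forall_rev_iff k).2 ⟨?_, ?_⟩
    · rw [Function.update_self, Function.update_of_ne hne]
      exact ⟨⟨(hsD k).1.1.trans hy'.1.le, hy'.2.le⟩, .inr hy.le⟩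
    · rw [Fin.rev_rev, Function.update_self, Function.update_of_ne hne]
      refine ⟨(hsD _).1, (hsD _).2.imp id fun h => hmono _ _ _ _ hy'.1.le ?_⟩
      rwa [Fin.rev_rev] at h
  have := hle _ hx k
  rw [Function.update_self] at this
  linarith [hy'.1]

variable {I : Info} {p p' : Fin 2 → ℝ} {c c' : ℝ} {e : Fin 2 → ℝ} {t t' : Fin 2 → ℝ}

/-- `t` is the equilibrium in which, for either sender `k`, the threshold of `k` is largest if
`e k = 1` and smallest if `e k = -1`. This covers the largest, the smallest, and the maximal
equilibria. -/
def IsExtremal (I : Info) (p : Fin 2 → ℝ) (c : ℝ) (e t : Fin 2 → ℝ) : Prop :=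
  IsEqThresholds I p c t ∧ ∀ t', IsEqThresholds I p c t' → ∀ k, e k * t' k ≤ e k * t k

lemma forall_isEquilibrium_iff (hp : ∀ k, p k ∈ Ioo (0 : ℝ) 1) (P : (Fin 2 → ℝ) → Prop) :
    (∀ σ, IsEquilibrium I p c σ → ∃ t', HasThresholds I σ t' ∧ P t') ↔
      ∀ t', IsEqThresholds I p c t' → P t' := by
  constructor
  · rintro h t' ⟨σ, hσ, ht'⟩
    obtain ⟨t'', ht'', hP⟩ := h σ hσ
    rwa [ht'.unique ht'']
  · intro h σ hσ
    obtain ⟨t', ht'⟩ := hσ.exists_hasThresholds hp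
    exact ⟨t', ht', h t' ⟨σ, hσ, ht'⟩⟩

lemma isSmallest_iff (hp : ∀ k, p k ∈ Ioo (0 : ℝ) 1) :
    IsSmallest I p c t ↔ IsExtremal I p c (fun _ => -1) t := by
  unfold IsSmallest IsExtremal
  rw [forall_isEquilibrium_iff hp]
  simp

lemma isLargest_iff (hp : ∀ k, p k ∈ Ioo (0 : ℝ) 1) :
    IsLargest I p c t ↔ IsExtremal I p c (fun _ => 1) t := by
  unfold IsLargest IsExtremal
  rw [forall_isEquilibrium_iff hp]
  simp

/-- The signs for which `IsExtremal` is `IsMaximalFor`. -/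
def maximalSign (i k : Fin 2) : ℝ := if k = i then 1 else -1

lemma maximalSign_eq (i k : Fin 2) : maximalSign i k = 1 ∨ maximalSign i k = -1 := by
  unfold maximalSign
  split_ifs <;> simp

lemma isMaximalFor_iff (hp : ∀ k, p k ∈ Ioo (0 : ℝ) 1) {i : Fin 2} :
    IsMaximalFor I p c i t ↔ IsExtremal I p c (maximalSign i) t := by
  have hne : i.rev ≠ i := by fin_cases i <;> simp
  unfold IsMaximalFor IsExtremal
  rw [forall_isEquilibrium_iff hp]
  simp [forall_rev_iff i, maximalSign, hne]

lemma IsExtremal.unique (he : ∀ k, e k = 1 ∨ e k = -1) (h : IsExtremal I p c e t)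
    (h' : IsExtremal I p c e t') : t = t' := by
  funext k
  have h1 := h.2 _ h'.1 k
  have h2 := h'.2 _ h.1 k
  rcases he k with he | he <;> rw [he] at h1 h2 <;> linarith

/-- At the thresholds `t`, no sender `k` gains from moving his threshold against the direction
`e k`, that is, down if `e k = 1` and up if `e k = -1`. -/
def IsStable (I : Info) (p : Fin 2 → ℝ) (c : ℝ) (e t : Fin 2 → ℝ) : Prop :=
  ∀ k, t k ∈ Icc I.lo I.hi ∧
    (e k * t k = min (e k * I.lo) (e k * I.hi) ∨ e k * gap I p t k ≤ e k * c)

lemma IsEqThresholds.isStable (hp : ∀ k, p k ∈ Ioo (0 : ℝ) 1) (he : ∀ k, e k = 1 ∨ e k = -1)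
    (h : IsEqThresholds I p c t) : IsStable I p c e t := by
  intro k
  have hlo := I.lo_lt_hi.le
  obtain ⟨h1, h2, h3⟩ := (isEqThresholds_iff hp).1 h k
  refine ⟨h1, ?_⟩
  rcases he k with he | he
  · simpa [he, hlo] using h2
  · simpa [he, hlo] using h3

lemma cutoff_le_cutoff {r r' z z' : ℝ} (hr : 0 ≤ r) (hr' : r ≤ r') (hz : z ≤ z') (s : ℝ) :
    cutoff r z' s ≤ cutoff r' z s := by
  unfold cutoff
  split_ifs <;> linarith

lemma continuous_silence_cutoff (I : Info) {r : ℝ} (hr : r ∈ Ioo (0 : ℝ) 1) (ω : Fin 2) :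
    Continuous fun z => silence I (cutoff r z) ω := by
  unfold silence
  refine continuous_const.sub (continuous_iff_continuousAt.2 fun z => ?_)
  refine continuousAt_of_dominated (bound := I.f ω) (.of_forall fun y =>
    ((isRate_cutoff I hr y).measurable.mul (I.f_measurable ω)).aestronglyMeasurable)
    (.of_forall fun y => ?_) (I.integrableOn_f ω) ?_
  · filter_upwards [(isRate_cutoff I hr y).ae_mem] with s hs
    have := I.f_nonneg ω s
    rw [Real.norm_eq_abs, abs_of_nonneg (mul_nonneg hs.1 this)]
    exact mul_le_of_le_one_left this hs.2
  · have hne : ∀ᵐ s ∂volume.restrict (Icc I.lo I.hi), s ≠ z := Measure.ae_ne _ _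
    filter_upwards [hne] with s hs
    refine ContinuousAt.mul ?_ continuousAt_const
    unfold cutoff
    rcases lt_or_gt_of_ne hs with hs | hs
    · refine continuousAt_const.congr (f := fun _ => (0 : ℝ)) ?_
      filter_upwards [lt_mem_nhds hs] with y hy
      rw [if_neg hy.not_gt]
    · refine continuousAt_const.congr (f := fun _ => r) ?_
      filter_upwards [gt_mem_nhds hs] with y hy
      rw [if_pos hy]

lemma continuous_silenceBelief_cutoff (I : Info) {r : ℝ} (hr : r ∈ Ioo (0 : ℝ) 1) :
    Continuous fun z => silenceBelief I (cutoff r z) := by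
  have h1 := continuous_silence_cutoff I hr 1
  have h0 := continuous_silence_cutoff I hr 0
  unfold silenceBelief
  refine Continuous.div (by fun_prop) (by fun_prop) fun z => ?_
  have h1 := mul_pos I.prior_pos (silence_pos (isRate_cutoff I hr z) 1)
  have h0 := mul_pos I.one_sub_prior_pos (silence_pos (isRate_cutoff I hr z) 0)
  positivity

lemma continuous_advantage_cutoff (I : Info) {r : ℝ} (hr : r ∈ Ioo (0 : ℝ) 1) {d : ℝ → ℝ}
    (hd : IsRate I d) : Continuous fun z => advantage I (cutoff r z) d z := by
  have h := continuous_silenceBelief_cutoff I hr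
  unfold advantage
  exact (continuous_id.sub h).mul ((continuousOn_residual hd).comp_continuous h fun z =>
    silenceBelief_mem (isRate_cutoff I hr z))

/-- More disclosure by the other sender scales the advantage of disclosure towards `0`, which
cannot raise it beyond a bound of which it was short. -/
lemma advantage_le_of_more {d d₁ d₂ : ℝ → ℝ} {z x b : ℝ} (hd : IsRate I d) (h₁ : IsRate I d₁)
    (h₂ : IsRate I d₂) (hle : ∀ s, d₁ s ≤ d₂ s) (hb : 0 ≤ x * b)
    (h : x * advantage I d d₁ z ≤ x * b) : x * advantage I d d₂ z ≤ x * b := by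
  have hη := silenceBelief_mem hd
  have h12 := residual_anti h₁ h₂ (.of_forall hle) hη.1 hη.2
  have h2 := residual_pos h₂ hη.1 hη.2
  unfold advantage at *
  rw [← mul_assoc] at *
  rcases le_total (x * (z - silenceBelief I d)) 0 with hx | hx
  · nlinarith
  · nlinarith

/-- Less disclosure by the other sender scales the advantage of disclosure away from `0`. -/
lemma advantage_le_of_less {d d₁ d₂ : ℝ → ℝ} {z x b : ℝ} (hd : IsRate I d) (h₁ : IsRate I d₁)
    (h₂ : IsRate I d₂) (hle : ∀ s, d₁ s ≤ d₂ s) (hb : x * b ≤ 0)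
    (h : x * advantage I d d₂ z ≤ x * b) : x * advantage I d d₁ z ≤ x * b := by
  have hη := silenceBelief_mem hd
  have h12 := residual_anti h₁ h₂ (.of_forall hle) hη.1 hη.2
  have h2 := residual_pos h₂ hη.1 hη.2
  unfold advantage at *
  rw [← mul_assoc] at *
  rcases le_or_gt (x * (z - silenceBelief I d)) 0 with hx | hx
  · nlinarith
  · nlinarith [mul_pos hx h2]

/-- The extremal equilibria exist if thresholds are strategic complements or substitutes according
to the signs `e`, and they dominate all stable thresholds. -/
lemma exists_isExtremal (I : Info) (hp : ∀ k, p k ∈ Ioo (0 : ℝ) 1) (he : ∀ k, e k = 1 ∨ e k = -1)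
    (hc : e 0 * e 1 * c ≤ 0) : ∃ t, IsExtremal I p c e t ∧
      ∀ t', IsStable I p c e t' → ∀ k, e k * t' k ≤ e k * t k := by
  have hcut (k : Fin 2) (z : ℝ) : IsRate I (cutoff (p k) z) := isRate_cutoff I (hp k) z
  have hlo := I.lo_lt_hi.le
  have hee (k : Fin 2) (x : ℝ) : e k * (e k * x) = x := by
    rcases he k with h | h <;> rw [h] <;> ring
  -- In the coordinates `e k * t k`, both thresholds are to be maximized.
  set H : Fin 2 → ℝ → ℝ → ℝ := fun k x y => e k * advantage I (cutoff (p k) (e k * x))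
    (cutoff (p k.rev) (e k.rev * y)) (e k * x) - e k * c with hH
  obtain ⟨s, hs, hmax⟩ := exists_greatest_balanced
    (a := fun k => min (e k * I.lo) (e k * I.hi)) (b := fun k => max (e k * I.lo) (e k * I.hi))
    (fun k => min_le_max) H (fun k y => by
      have := (continuous_advantage_cutoff I (hp k) (hcut k.rev (e k.rev * y))).comp
        (continuous_const_mul (e k))
      exact (continuous_const.mul this).sub continuous_const) (fun k x y y' hy h => by
      have hck : e k * (e k.rev * c) ≤ 0 := by
        revert k
        simp only [Fin.forall_fin_two]
        exact ⟨fun _ => by simpa [mul_assoc] using hc,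
          fun _ => by simpa [mul_assoc, mul_left_comm] using hc⟩
      simp only [hH, sub_nonpos] at h ⊢
      rcases he k.rev with hk | hk
      · refine advantage_le_of_less (hcut _ _) (hcut _ _) (hcut _ _)
          (cutoff_le_cutoff (hp k.rev).1.le le_rfl ?_) ?_ h
        · rw [hk]; linarith
        · rw [hk] at hck; linarith
      · refine advantage_le_of_more (hcut _ _) (hcut _ _) (hcut _ _)
          (cutoff_le_cutoff (hp k.rev).1.le le_rfl ?_) ?_ h
        · rw [hk]; linarith
        · rw [hk] at hck; linarith)
  have hstab (t' : Fin 2 → ℝ) (ht' : IsStable I p c e t') (k : Fin 2) : e k * t' k ≤ s k := by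
    refine hmax (fun k => e k * t' k) (fun k => ⟨?_, (ht' k).2.imp id fun h => ?_⟩) k
    · have := (ht' k).1
      rcases he k with hk | hk <;> simp [hk, hlo, this.1, this.2]
    · simp only [hH, hee, sub_nonpos]
      exact h
  refine ⟨fun k => e k * s k, ⟨(isEqThresholds_iff hp).2 fun k => ?_, fun t' ht' k => ?_⟩,
    fun t' ht' k => ?_⟩
  · obtain ⟨h1, h2, h3⟩ := hs k
    simp only [hH, sub_nonpos, sub_nonneg] at h2 h3
    unfold gap
    rcases he k with hk | hk
    · simp only [hk, one_mul, min_eq_left hlo, max_eq_right hlo] at h1 h2 h3 ⊢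
      exact ⟨h1, h2, h3⟩
    · simp only [hk, neg_mul, one_mul, min_eq_right (neg_le_neg hlo), max_eq_left (neg_le_neg hlo),
        neg_le_neg_iff] at h1 h2 h3 ⊢
      exact ⟨⟨by linarith [h1.2], by linarith [h1.1]⟩, h3.imp (by rintro h; linarith) id,
        h2.imp (by rintro h; linarith) id⟩
  · rw [hee]
    exact hstab t' (ht'.isStable hp he) k
  · rw [hee]
    exact hstab t' ht' k

lemma IsExtremal.of_isStable (hp : ∀ k, p k ∈ Ioo (0 : ℝ) 1) (he : ∀ k, e k = 1 ∨ e k = -1)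
    (hc : e 0 * e 1 * c ≤ 0) (h : IsExtremal I p c e t) (h' : IsStable I p c e t') (k : Fin 2) :
    e k * t' k ≤ e k * t k := by
  obtain ⟨t₀, ht₀, hmax⟩ := exists_isExtremal I hp he hc
  rw [h.unique he ht₀]
  exact hmax t' h' k

/-! ### Comparative statics -/

/-- Silence is weakly worse news if the sender is more likely to be informed: the signals above any
threshold are, on average, good news. -/
lemma silenceBelief_cutoff_anti (I : Info) {r r' : ℝ} (hr : r ∈ Ioo (0 : ℝ) 1)
    (hr' : r' ∈ Ioo (0 : ℝ) 1) (hle : r ≤ r') (z : ℝ) :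
    silenceBelief I (cutoff r' z) ≤ silenceBelief I (cutoff r z) := by
  have hπ := I.prior_pos
  have hπ' := I.one_sub_prior_pos
  -- `S ω` is the probability of a signal above `z` in state `ω`.
  set S : Fin 2 → ℝ := fun ω => ∫ s in Icc I.lo I.hi, (Ioi z).indicator 1 s * I.f ω s with hS
  have hsil (q : ℝ) (ω : Fin 2) : silence I (cutoff q z) ω = 1 - q * S ω := by
    simp only [silence, hS, ← integral_const_mul]
    congr 2
    ext s
    by_cases h : z < s <;> simp [cutoff, h]
  have hi (ω : Fin 2) :
      IntegrableOn (fun s => (Ioi z).indicator 1 s * I.f ω s) (Icc I.lo I.hi) := by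
    have : (fun s => (Ioi z).indicator 1 s * I.f ω s) = (Ioi z).indicator (I.f ω) := by
      ext s
      by_cases h : z < s <;> simp [h]
    rw [this]
    exact (I.integrableOn_f ω).indicator measurableSet_Ioi
  have hS01 : S 0 ≤ S 1 := by
    have e1 : I.prior * (1 - I.prior) * (S 1 - S 0) = ∫ s in Icc I.lo I.hi,
        (I.prior * (1 - I.prior)) * ((Ioi z).indicator 1 s * I.f 1 s -
          (Ioi z).indicator 1 s * I.f 0 s) := by
      rw [integral_const_mul, integral_sub (hi 1) (hi 0)]
    have e2 : ∫ s in Icc I.lo I.hi, (I.prior * (1 - I.prior)) * (I.f 1 s - I.f 0 s) = 0 := by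
      rw [integral_const_mul, integral_sub (I.integrableOn_f 1) (I.integrableOn_f 0), I.f_total,
        I.f_total, sub_self, mul_zero]
    have e3 : 0 ≤ I.prior * (1 - I.prior) * (S 1 - S 0) := by
      rcases le_total I.prior z with hz | hz
      · rw [e1]
        refine integral_nonneg_of_ae ?_
        filter_upwards [I.ae_posterior] with s hs
        have hm := I.mix_nonneg s
        by_cases h : z < s
        · simp only [Pi.zero_apply, mem_Ioi, h, indicator_of_mem, Pi.one_apply, one_mul]
          have : I.prior * (1 - I.prior) * (I.f 1 s - I.f 0 s) = (s - I.prior) * I.mix s := by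
            linear_combination (1 - I.prior) * hs.2.1 - I.prior * hs.2.2
          rw [this]
          exact mul_nonneg (by linarith) hm
        · simp [h]
      · rw [e1, ← e2]
        refine integral_mono_ae (((I.integrableOn_f 1).sub (I.integrableOn_f 0)).const_mul _)
          (((hi 1).sub (hi 0)).const_mul _) ?_
        filter_upwards [I.ae_posterior] with s hs
        have hm := I.mix_nonneg s
        by_cases h : z < s
        · simp [h]
        · simp only [mem_Ioi, h, not_false_eq_true, indicator_of_notMem, zero_mul, sub_self,
            mul_zero]
          have : I.prior * (1 - I.prior) * (I.f 1 s - I.f 0 s) = (s - I.prior) * I.mix s := by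
            linear_combination (1 - I.prior) * hs.2.1 - I.prior * hs.2.2
          rw [this]
          exact mul_nonpos_of_nonpos_of_nonneg (by linarith) hm
    have := mul_pos hπ hπ'
    by_contra! hlt
    nlinarith
  have h1 := silence_pos (isRate_cutoff I hr z) 1
  have h0 := silence_pos (isRate_cutoff I hr z) 0
  have h1' := silence_pos (isRate_cutoff I hr' z) 1
  have h0' := silence_pos (isRate_cutoff I hr' z) 0
  unfold silenceBelief
  rw [hsil] at h1 h0 h1' h0'
  simp only [hsil]
  rw [div_le_div_iff₀ (by positivity) (by positivity)]
  have : (1 - r' * S 1) * (1 - r * S 0) ≤ (1 - r * S 1) * (1 - r' * S 0) := by nlinarith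
  nlinarith [mul_le_mul_of_nonneg_left this (mul_pos hπ hπ').le]

/-- A sender who is more likely to be informed gains weakly more from disclosure of any given
threshold type. -/
lemma advantage_cutoff_mono {r r' : ℝ} (hr : r ∈ Ioo (0 : ℝ) 1)
    (hr' : r' ∈ Ioo (0 : ℝ) 1) (hle : r ≤ r') {d : ℝ → ℝ} (hd : IsRate I d) {z : ℝ}
    (hz : z ∈ Icc I.lo I.hi) :
    advantage I (cutoff r z) d z ≤ advantage I (cutoff r' z) d z :=
  sub_mul_residual_anti hd (I.mem_unit hz) (silenceBelief_mem (isRate_cutoff I hr' z)).1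
    (silenceBelief_cutoff_anti I hr hr' hle z) (silenceBelief_mem (isRate_cutoff I hr z)).2

/-- An increase in the probability that sender `i` is informed moves his threshold down, and the
other threshold in the direction in which strategic complements or substitutes take it. -/
lemma IsExtremal.of_prob_le (hp : ∀ k, p k ∈ Ioo (0 : ℝ) 1) (hp' : ∀ k, p' k ∈ Ioo (0 : ℝ) 1)
    (he : ∀ k, e k = 1 ∨ e k = -1) (hc : e 0 * e 1 * c ≤ 0) {i : Fin 2} (hi : p i ≤ p' i)
    (hj : p' i.rev = p i.rev) (h : IsExtremal I p c e t) (h' : IsExtremal I p' c e t') (k : Fin 2) :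
    e i * (e k * t' k) ≤ e i * (e k * t k) := by
  have hcut (k : Fin 2) (z : ℝ) : IsRate I (cutoff (p k) z) := isRate_cutoff I (hp k) z
  have hcut' (k : Fin 2) (z : ℝ) : IsRate I (cutoff (p' k) z) := isRate_cutoff I (hp' k) z
  have hci : e i * (e i.rev * c) ≤ 0 := by
    revert i
    simp only [Fin.forall_fin_two]
    exact ⟨fun _ _ => by simpa [mul_assoc] using hc,
      fun _ _ => by simpa [mul_assoc, mul_left_comm] using hc⟩
  have own (t : Fin 2 → ℝ) (ht : t i ∈ Icc I.lo I.hi) : gap I p t i ≤ gap I p' t i := by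
    unfold gap
    rw [hj]
    exact advantage_cutoff_mono (hp i) (hp' i) hi (hcut _ _) ht
  have hle (t : Fin 2 → ℝ) (s : ℝ) : cutoff (p i) (t i) s ≤ cutoff (p' i) (t i) s :=
    cutoff_le_cutoff (hp i).1.le hi le_rfl s
  rcases he i with hei | hei
  · have hstab : IsStable I p c e t' := by
      have hs := (forall_rev_iff i).1 (h'.1.isStable hp' he)
      refine (forall_rev_iff i).2 ⟨⟨hs.1.1, hs.1.2.imp id fun h => ?_⟩,
        ⟨hs.2.1, hs.2.2.imp id fun h => ?_⟩⟩
      · rw [hei] at h ⊢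
        linarith [own t' hs.1.1]
      · rw [hei] at hci
        unfold gap at h ⊢
        rw [Fin.rev_rev] at h ⊢
        rw [hj] at h
        exact advantage_le_of_less (hcut _ _) (hcut _ _) (hcut' _ _) (hle t') (by linarith) h
    rw [hei, one_mul, one_mul]
    exact h.of_isStable hp he hc hstab k
  · have hstab : IsStable I p' c e t := by
      have hs := (forall_rev_iff i).1 (h.1.isStable hp he)
      refine (forall_rev_iff i).2 ⟨⟨hs.1.1, hs.1.2.imp id fun h => ?_⟩,
        ⟨hs.2.1, hs.2.2.imp id fun h => ?_⟩⟩
      · rw [hei] at h ⊢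
        linarith [own t hs.1.1]
      · rw [hei] at hci
        unfold gap at h ⊢
        rw [Fin.rev_rev] at h ⊢
        rw [hj]
        exact advantage_le_of_more (hcut _ _) (hcut _ _) (hcut' _ _) (hle t) (by linarith) h
    have := h'.of_isStable hp' he hc hstab k
    rw [hei]
    linarith

/-- A lower cost moves both thresholds down in the smallest (`x = -1`) and the largest (`x = 1`)
equilibrium. -/
lemma IsExtremal.of_cost_le (hp : ∀ k, p k ∈ Ioo (0 : ℝ) 1) {x : ℝ} (hx : x = 1 ∨ x = -1)
    (hc : c ≤ 0) (hcc : c' ≤ c) (h : IsExtremal I p c (fun _ => x) t)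
    (h' : IsExtremal I p c' (fun _ => x) t') (k : Fin 2) : t' k ≤ t k := by
  rcases hx with rfl | rfl
  · have hs := h'.1.isStable hp (e := fun _ => 1) (by simp)
    have := h.of_isStable (t' := t') hp (by simp) (by linarith)
      (fun k => ⟨(hs k).1, (hs k).2.imp id fun h => by linarith⟩) k
    linarith
  · have hs := h.1.isStable hp (e := fun _ => -1) (by simp)
    have := h'.of_isStable (t' := t) hp (by simp) (by linarith)
      (fun k => ⟨(hs k).1, (hs k).2.imp id fun h => by linarith⟩) k
    linarith

end

section

/-! ### Welfare of the decision maker -/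

variable {A : Type} {u : A → Fin 2 → ℝ} {K : ℝ}

/-- Value of a decision problem when the states `1` and `0` have the masses `x` and `y`, which need
not add up to `1`. -/
noncomputable def value (u : A → Fin 2 → ℝ) (x y : ℝ) : ℝ := ⨆ a, (x * u a 1 + y * u a 0)

lemma abs_payoff_le (hu : ∀ a ω, |u a ω| ≤ K) (x y : ℝ) (a : A) :
    |x * u a 1 + y * u a 0| ≤ K * (|x| + |y|) := by
  refine (abs_add_le _ _).trans ?_
  rw [abs_mul, abs_mul]
  nlinarith [hu a 0, hu a 1, abs_nonneg x, abs_nonneg y]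

lemma le_value (hu : ∀ a ω, |u a ω| ≤ K) (x y : ℝ) (a : A) :
    x * u a 1 + y * u a 0 ≤ value u x y := by
  refine le_ciSup (f := fun a => x * u a 1 + y * u a 0) ⟨K * (|x| + |y|), ?_⟩ a
  rintro _ ⟨a, rfl⟩
  exact (abs_le.1 (abs_payoff_le hu x y a)).2

lemma value_mul {k : ℝ} (hk : 0 ≤ k) (x y : ℝ) : value u (k * x) (k * y) = k * value u x y := by
  unfold value
  rw [Real.mul_iSup_of_nonneg hk]
  congr 1
  ext a
  ring

/-- Multiplying the value at the posterior by the mass of a message gives the value at the masses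
of the two states. -/
lemma value_posterior {X Y : ℝ} (hX : 0 ≤ X) (hY : 0 ≤ Y) :
    X * value u (X / (X + Y)) (1 - X / (X + Y)) + Y * value u (X / (X + Y)) (1 - X / (X + Y)) =
      value u X Y := by
  rw [← add_mul, ← value_mul (add_nonneg hX hY)]
  rcases (add_nonneg hX hY).eq_or_lt with h | h
  · have hX0 : X = 0 := by linarith
    have hY0 : Y = 0 := by linarith
    simp [hX0, hY0]
  · congr 1 <;> field_simp
    ring

variable {I : Info} {d d' d₀ d₁ : ℝ → ℝ}

/-- Value to a decision maker with masses `x`, `y` of the states of hearing a sender with disclosure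
rate `d`. -/
noncomputable def hearing (u : A → Fin 2 → ℝ) (I : Info) (d : ℝ → ℝ) (x y : ℝ) : ℝ :=
  (∫ s in Icc I.lo I.hi, d s * value u (x * I.f 1 s) (y * I.f 0 s)) +
    value u (x * silence I d 1) (y * silence I d 0)

lemma hearing_mul {k : ℝ} (hk : 0 ≤ k) (x y : ℝ) :
    hearing u I d (k * x) (k * y) = k * hearing u I d x y := by
  simp only [hearing, mul_assoc k, value_mul hk, mul_left_comm _ k, integral_const_mul, mul_add]

variable [Nonempty A]

lemma abs_value_le (hu : ∀ a ω, |u a ω| ≤ K) (x y : ℝ) : |value u x y| ≤ K * (|x| + |y|) := by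
  obtain ⟨a⟩ := ‹Nonempty A›
  rw [abs_le]
  exact ⟨(abs_le.1 (abs_payoff_le hu x y a)).1.trans (le_value hu x y a),
    haveI : Nonempty A := ⟨a⟩
    ciSup_le fun a => (abs_le.1 (abs_payoff_le hu x y a)).2⟩

lemma continuous_value (hu : ∀ a ω, |u a ω| ≤ K) :
    Continuous fun z : ℝ × ℝ => value u z.1 z.2 := by
  have hK : 0 ≤ K := (abs_nonneg _).trans (hu (Classical.arbitrary A) 0)
  refine (LipschitzWith.of_le_add_mul (⟨2 * K, by positivity⟩ : NNReal) fun z z' => ?_).continuous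
  refine ciSup_le fun a => ?_
  have h1 := le_value hu z'.1 z'.2 a
  have h2 := (abs_le.1 (abs_payoff_le hu (z.1 - z'.1) (z.2 - z'.2) a)).2
  have h3 : |z.1 - z'.1| ≤ dist z z' := by
    rw [← Real.dist_eq, Prod.dist_eq]
    exact le_max_left _ _
  have h4 : |z.2 - z'.2| ≤ dist z z' := by
    rw [← Real.dist_eq, Prod.dist_eq]
    exact le_max_right _ _
  have h5 := mul_le_mul_of_nonneg_left (add_le_add h3 h4) hK
  change _ ≤ _ + 2 * K * dist z z'
  linarith

lemma measurable_value_f (hu : ∀ a ω, |u a ω| ≤ K) (I : Info) (x y : ℝ) :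
    Measurable fun s => value u (x * I.f 1 s) (y * I.f 0 s) :=
  (continuous_value hu).measurable.comp
    (((I.f_measurable 1).const_mul x).prodMk ((I.f_measurable 0).const_mul y))

lemma integrableOn_value_f (hu : ∀ a ω, |u a ω| ≤ K) (I : Info) (x y : ℝ) :
    IntegrableOn (fun s => value u (x * I.f 1 s) (y * I.f 0 s)) (Icc I.lo I.hi) := by
  refine Integrable.mono' ((((I.integrableOn_f 1).const_mul x).abs.add
    ((I.integrableOn_f 0).const_mul y).abs).const_mul K)
    (measurable_value_f hu I x y).aestronglyMeasurable (.of_forall fun s => ?_)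
  exact abs_value_le hu _ _

/-- Hearing a sender who discloses more is worth more, because `value` is sublinear. -/
lemma hearing_mono (hu : ∀ a ω, |u a ω| ≤ K) (h : IsRate I d) (h' : IsRate I d')
    (hle : d ≤ᵐ[volume.restrict (Icc I.lo I.hi)] d') (x y : ℝ) :
    hearing u I d x y ≤ hearing u I d' x y := by
  have hv := integrableOn_value_f hu I x y
  have hi (ω : Fin 2) : IntegrableOn (fun s => (d' s - d s) * I.f ω s) (Icc I.lo I.hi) := by
    simp only [sub_mul]
    exact (h'.integrable ω).sub (h.integrable ω)
  have hv' : IntegrableOn (fun s => (d' s - d s) * value u (x * I.f 1 s) (y * I.f 0 s))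
      (Icc I.lo I.hi) := by
    simp only [sub_mul]
    exact (h'.integrable_mul hv).sub (h.integrable_mul hv)
  have e : ∫ s in Icc I.lo I.hi, (d' s - d s) * value u (x * I.f 1 s) (y * I.f 0 s) =
      (∫ s in Icc I.lo I.hi, d' s * value u (x * I.f 1 s) (y * I.f 0 s)) -
        ∫ s in Icc I.lo I.hi, d s * value u (x * I.f 1 s) (y * I.f 0 s) := by
    simp only [sub_mul]
    exact integral_sub (h'.integrable_mul hv) (h.integrable_mul hv)
  have key : value u (x * silence I d 1) (y * silence I d 0) ≤
      value u (x * silence I d' 1) (y * silence I d' 0) +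
        ∫ s in Icc I.lo I.hi, (d' s - d s) * value u (x * I.f 1 s) (y * I.f 0 s) := by
    refine ciSup_le fun a => ?_
    have h1 := le_value hu (x * silence I d' 1) (y * silence I d' 0) a
    have h2 : ∫ s in Icc I.lo I.hi, (x * u a 1 * ((d' s - d s) * I.f 1 s) +
        y * u a 0 * ((d' s - d s) * I.f 0 s)) ≤
        ∫ s in Icc I.lo I.hi, (d' s - d s) * value u (x * I.f 1 s) (y * I.f 0 s) := by
      refine integral_mono_ae (((hi 1).const_mul _).add ((hi 0).const_mul _)) hv' ?_
      filter_upwards [hle] with s hs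
      have := mul_le_mul_of_nonneg_left (le_value hu (x * I.f 1 s) (y * I.f 0 s) a)
        (sub_nonneg.2 hs)
      linarith
    rw [integral_add ((hi 1).const_mul _) ((hi 0).const_mul _), integral_const_mul,
      integral_const_mul, ← silence_sub h h', ← silence_sub h h'] at h2
    linarith
  unfold hearing
  linarith

/-- Value to the decision maker of hearing two senders with the disclosure rates `d₀` and `d₁`. -/
noncomputable def hearingBoth (u : A → Fin 2 → ℝ) (I : Info) (d₀ d₁ : ℝ → ℝ) : ℝ :=
  (∫ s in Icc I.lo I.hi, d₀ s * hearing u I d₁ (I.prior * I.f 1 s) ((1 - I.prior) * I.f 0 s)) +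
    hearing u I d₁ (I.prior * silence I d₀ 1) ((1 - I.prior) * silence I d₀ 0)

lemma integrable_value_prod (hu : ∀ a ω, |u a ω| ≤ K) (h₀ : IsRate I d₀) (h₁ : IsRate I d₁) :
    Integrable (fun z : ℝ × ℝ => d₀ z.1 * (d₁ z.2 * value u (I.prior * I.f 1 z.1 * I.f 1 z.2)
      ((1 - I.prior) * I.f 0 z.1 * I.f 0 z.2)))
      ((volume.restrict (Icc I.lo I.hi)).prod (volume.restrict (Icc I.lo I.hi))) := by
  have hK : 0 ≤ K := (abs_nonneg _).trans (hu (Classical.arbitrary A) 0)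
  have hi (ω : Fin 2) := (h₀.integrable ω).mul_prod (h₁.integrable ω)
  have hm1 := I.f_measurable 1
  have hm0 := I.f_measurable 0
  have hd0 := h₀.measurable
  have hd1 := h₁.measurable
  refine Integrable.mono' ((((hi 1).const_mul I.prior).add
    ((hi 0).const_mul (1 - I.prior))).const_mul K) ?_ ?_
  · have hv : Measurable fun z : ℝ × ℝ => value u (I.prior * I.f 1 z.1 * I.f 1 z.2)
        ((1 - I.prior) * I.f 0 z.1 * I.f 0 z.2) :=
      (continuous_value hu).measurable.comp (Measurable.prodMk (by fun_prop) (by fun_prop))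
    exact Measurable.aestronglyMeasurable (by fun_prop)
  · rw [Measure.prod_restrict, ae_restrict_iff' (measurableSet_Icc.prod measurableSet_Icc)]
    refine .of_forall fun z hz => ?_
    have n0 := h₀.nonneg z.1 hz.1
    have n1 := h₁.nonneg z.2 hz.2
    have f0 := I.f_nonneg 0 z.1
    have f1 := I.f_nonneg 1 z.1
    have g0 := I.f_nonneg 0 z.2
    have g1 := I.f_nonneg 1 z.2
    have hπ := I.prior_pos
    have hπ' := I.one_sub_prior_pos
    have := abs_value_le hu (I.prior * I.f 1 z.1 * I.f 1 z.2)
      ((1 - I.prior) * I.f 0 z.1 * I.f 0 z.2)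
    rw [abs_of_nonneg (by positivity : 0 ≤ I.prior * I.f 1 z.1 * I.f 1 z.2),
      abs_of_nonneg (by positivity : 0 ≤ (1 - I.prior) * I.f 0 z.1 * I.f 0 z.2)] at this
    rw [Real.norm_eq_abs, abs_mul, abs_mul, abs_of_nonneg n0, abs_of_nonneg n1, ← mul_assoc]
    calc _ ≤ _ := mul_le_mul_of_nonneg_left this (mul_nonneg n0 n1)
      _ = _ := by simp only [Pi.add_apply]; ring

lemma integrable_hearing (hu : ∀ a ω, |u a ω| ≤ K) (h₀ : IsRate I d₀) (h₁ : IsRate I d₁) :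
    IntegrableOn (fun s => d₀ s * hearing u I d₁ (I.prior * I.f 1 s) ((1 - I.prior) * I.f 0 s))
      (Icc I.lo I.hi) := by
  have h1 := (integrable_value_prod hu h₀ h₁).integral_prod_left
  simp only [integral_const_mul] at h1
  have h2 := h₀.integrable_mul (integrableOn_value_f hu I (I.prior * silence I d₁ 1)
    ((1 - I.prior) * silence I d₁ 0))
  simp only [hearing, mul_add]
  refine h1.add (h2.congr (.of_forall fun s => ?_))
  simp only [mul_right_comm]

lemma hearingBoth_comm (hu : ∀ a ω, |u a ω| ≤ K) (h₀ : IsRate I d₀) (h₁ : IsRate I d₁) :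
    hearingBoth u I d₀ d₁ = hearingBoth u I d₁ d₀ := by
  have expand {d₀ d₁ : ℝ → ℝ} (h₀ : IsRate I d₀) (h₁ : IsRate I d₁) : hearingBoth u I d₀ d₁ =
      (∫ s in Icc I.lo I.hi, ∫ x in Icc I.lo I.hi, d₀ s * (d₁ x *
        value u (I.prior * I.f 1 s * I.f 1 x) ((1 - I.prior) * I.f 0 s * I.f 0 x))) +
      (∫ s in Icc I.lo I.hi, d₀ s * value u (I.prior * silence I d₁ 1 * I.f 1 s)
        ((1 - I.prior) * silence I d₁ 0 * I.f 0 s)) +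
      ((∫ s in Icc I.lo I.hi, d₁ s * value u (I.prior * silence I d₀ 1 * I.f 1 s)
        ((1 - I.prior) * silence I d₀ 0 * I.f 0 s)) +
      value u (I.prior * silence I d₀ 1 * silence I d₁ 1)
        ((1 - I.prior) * silence I d₀ 0 * silence I d₁ 0)) := by
    have h1 := (integrable_value_prod hu h₀ h₁).integral_prod_left
    have h2 := h₀.integrable_mul (integrableOn_value_f hu I (I.prior * silence I d₁ 1)
      ((1 - I.prior) * silence I d₁ 0))
    rw [← integral_add h1 h2]
    simp only [hearingBoth, hearing, mul_add, integral_const_mul,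
      fun s => mul_right_comm I.prior (I.f 1 s) (silence I d₁ 1),
      fun s => mul_right_comm (1 - I.prior) (I.f 0 s) (silence I d₁ 0)]
  have e : ∫ s in Icc I.lo I.hi, ∫ x in Icc I.lo I.hi, d₀ x * (d₁ s *
        value u (I.prior * I.f 1 x * I.f 1 s) ((1 - I.prior) * I.f 0 x * I.f 0 s)) =
      ∫ s in Icc I.lo I.hi, ∫ x in Icc I.lo I.hi, d₁ s * (d₀ x *
        value u (I.prior * I.f 1 s * I.f 1 x) ((1 - I.prior) * I.f 0 s * I.f 0 x)) := by
    refine integral_congr_ae (.of_forall fun s => integral_congr_ae (.of_forall fun x => ?_))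
    simp only []
    rw [mul_left_comm, mul_right_comm I.prior, mul_right_comm (1 - I.prior)]
  rw [expand h₀ h₁, expand h₁ h₀, integral_integral_swap (integrable_value_prod hu h₀ h₁), e,
    mul_right_comm I.prior (silence I d₁ 1), mul_right_comm (1 - I.prior) (silence I d₁ 0)]
  ring

/-- The decision maker gains from more disclosure by both senders. -/
lemma hearingBoth_mono {d₀' d₁' : ℝ → ℝ} (hu : ∀ a ω, |u a ω| ≤ K) (h₀ : IsRate I d₀)
    (h₁ : IsRate I d₁) (h₀' : IsRate I d₀') (h₁' : IsRate I d₁')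
    (hle₀ : d₀ ≤ᵐ[volume.restrict (Icc I.lo I.hi)] d₀')
    (hle₁ : d₁ ≤ᵐ[volume.restrict (Icc I.lo I.hi)] d₁') :
    hearingBoth u I d₀ d₁ ≤ hearingBoth u I d₀' d₁' := by
  have step {d₀ d₁ d₁' : ℝ → ℝ} (h₀ : IsRate I d₀) (h₁ : IsRate I d₁) (h₁' : IsRate I d₁')
      (hle : d₁ ≤ᵐ[volume.restrict (Icc I.lo I.hi)] d₁') :
      hearingBoth u I d₀ d₁ ≤ hearingBoth u I d₀ d₁' :=
    add_le_add (setIntegral_mono_on (integrable_hearing hu h₀ h₁) (integrable_hearing hu h₀ h₁')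
      measurableSet_Icc fun s hs =>
        mul_le_mul_of_nonneg_left (hearing_mono hu h₁ h₁' hle _ _) (h₀.nonneg s hs))
      (hearing_mono hu h₁ h₁' hle _ _)
  calc _ ≤ hearingBoth u I d₀ d₁' := step h₀ h₁ h₁' hle₁
    _ = hearingBoth u I d₁' d₀ := hearingBoth_comm hu h₀ h₁'
    _ ≤ hearingBoth u I d₁' d₀' := step h₁' h₀ h₀' hle₀
    _ = _ := hearingBoth_comm hu h₁' h₀'

variable {p : Fin 2 → ℝ} {c : ℝ} {σ σ' : Profile}

lemma belief_pair (I : Info) (p : Fin 2 → ℝ) (σ : Profile) (m₀ m₁ : Option ℝ) :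
    belief I p σ ![m₀, m₁] = I.prior * (lik I p σ 0 1 m₀ * lik I p σ 1 1 m₁) /
      (I.prior * (lik I p σ 0 1 m₀ * lik I p σ 1 1 m₁) +
        (1 - I.prior) * (lik I p σ 0 0 m₀ * lik I p σ 1 0 m₁)) := by
  simp [belief, Fin.prod_univ_two]

lemma lik_some_nonneg (i ω : Fin 2) {s : ℝ} (hs : s ∈ Icc I.lo I.hi) :
    0 ≤ lik I p σ i ω (some s) := by
  have h := I.mem_unit hs
  have := h.1
  have := sub_nonneg.2 h.2
  have := I.prior_pos
  have := I.one_sub_prior_pos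
  simp only [lik]
  split_ifs <;> positivity

lemma f_eq_lik (I : Info) (p : Fin 2 → ℝ) (σ : Profile) (i : Fin 2) :
    ∀ᵐ s ∂volume.restrict (Icc I.lo I.hi), s ∈ Icc I.lo I.hi ∧
      ∀ ω, I.f ω s = I.mix s * lik I p σ i ω (some s) := by
  filter_upwards [I.f_eq] with s hs
  refine ⟨hs.1, ?_⟩
  simp only [Fin.forall_fin_two]
  rw [lik_some_one, lik_some_zero]
  exact ⟨hs.2.2, hs.2.1⟩

lemma measurable_lik_some (I : Info) (p : Fin 2 → ℝ) (σ : Profile) (i ω : Fin 2) :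
    Measurable fun s => lik I p σ i ω (some s) := by
  simp only [lik]
  split_ifs <;> fun_prop

lemma abs_value_belief_le (hu : ∀ a ω, |u a ω| ≤ K) {m₀ m₁ : Option ℝ}
    (h₀ : ∀ ω, 0 ≤ lik I p σ 0 ω m₀) (h₁ : ∀ ω, 0 ≤ lik I p σ 1 ω m₁) :
    |value u (belief I p σ ![m₀, m₁]) (1 - belief I p σ ![m₀, m₁])| ≤ K := by
  have h1 := mul_nonneg I.prior_pos.le (mul_nonneg (h₀ 1) (h₁ 1))
  have h0 := mul_nonneg I.one_sub_prior_pos.le (mul_nonneg (h₀ 0) (h₁ 0))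
  have hb : belief I p σ ![m₀, m₁] ∈ Icc (0 : ℝ) 1 := by
    rw [belief_pair]
    exact ⟨div_nonneg h1 (by linarith), div_le_one_of_le₀ (by linarith) (by linarith)⟩
  have := abs_value_le hu (belief I p σ ![m₀, m₁]) (1 - belief I p σ ![m₀, m₁])
  rw [abs_of_nonneg hb.1, abs_of_nonneg (sub_nonneg.2 hb.2)] at this
  linarith

lemma measurable_value_belief (hu : ∀ a ω, |u a ω| ≤ K) {X : Type*} [MeasurableSpace X]
    {m₀ m₁ : X → Option ℝ} (h₀ : ∀ ω, Measurable fun x => lik I p σ 0 ω (m₀ x))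
    (h₁ : ∀ ω, Measurable fun x => lik I p σ 1 ω (m₁ x)) :
    Measurable fun x => value u (belief I p σ ![m₀ x, m₁ x]) (1 - belief I p σ ![m₀ x, m₁ x]) := by
  have := h₀ 0
  have := h₀ 1
  have := h₁ 0
  have := h₁ 1
  have hb : Measurable fun x => belief I p σ ![m₀ x, m₁ x] := by
    simp only [belief_pair]
    fun_prop
  exact (continuous_value hu).measurable.comp (hb.prodMk (hb.const_sub 1))

/-- Expected value of the decision problem in state `ω` when sender `0` sends `m₀`. -/
noncomputable def valueAfter (u : A → Fin 2 → ℝ) (I : Info) (p : Fin 2 → ℝ) (σ : Profile)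
    (ω : Fin 2) (m₀ : Option ℝ) : ℝ :=
  msgExp I p σ 1 ω fun m₁ => value u (belief I p σ ![m₀, m₁]) (1 - belief I p σ ![m₀, m₁])

lemma msgExp_eq {i : Fin 2} (h : IsRate I (rate p σ i)) (ω : Fin 2) (g : Option ℝ → ℝ) :
    msgExp I p σ i ω g = (∫ s in Icc I.lo I.hi, rate p σ i s * (I.f ω s * g (some s))) +
      silence I (rate p σ i) ω * g none := by
  simp only [msgExp, ndProb_eq_silence h, rate, mul_assoc]

lemma lik_none_nonneg {i : Fin 2} (h : IsRate I (rate p σ i)) (ω : Fin 2) :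
    0 ≤ lik I p σ i ω none := by
  simp only [lik, ndProb_eq_silence h]
  exact (silence_pos h ω).le

lemma integrable_value_belief (hu : ∀ a ω, |u a ω| ≤ K) (ω : Fin 2) {m₀ : Option ℝ}
    (h₀ : ∀ ω, 0 ≤ lik I p σ 0 ω m₀) :
    IntegrableOn (fun s => I.f ω s * value u (belief I p σ ![m₀, some s])
      (1 - belief I p σ ![m₀, some s])) (Icc I.lo I.hi) := by
  refine Integrable.mul_bdd (c := K) (I.integrableOn_f ω) (measurable_value_belief hu
    (fun ω => measurable_const) fun ω => measurable_lik_some I p σ 1 ω).aestronglyMeasurable ?_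
  rw [ae_restrict_iff' measurableSet_Icc]
  exact .of_forall fun s hs => abs_value_belief_le hu h₀ fun ω => lik_some_nonneg 1 ω hs

lemma valueAfter_eq_hearing (hu : ∀ a ω, |u a ω| ≤ K) (h : IsRate I (rate p σ 1)) {m₀ : Option ℝ}
    (h₀ : ∀ ω, 0 ≤ lik I p σ 0 ω m₀) :
    I.prior * lik I p σ 0 1 m₀ * valueAfter u I p σ 1 m₀ +
      (1 - I.prior) * lik I p σ 0 0 m₀ * valueAfter u I p σ 0 m₀ =
      hearing u I (rate p σ 1) (I.prior * lik I p σ 0 1 m₀)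
        ((1 - I.prior) * lik I p σ 0 0 m₀) := by
  have hπ := I.prior_pos.le
  have hπ' := I.one_sub_prior_pos.le
  set x := lik I p σ 0 1 m₀ with hx
  set y := lik I p σ 0 0 m₀ with hy
  set v : Option ℝ → ℝ := fun m₁ => value u (belief I p σ ![m₀, m₁]) (1 - belief I p σ ![m₀, m₁])
    with hv
  have hval (m₁ : Option ℝ) (h₁ : ∀ ω, 0 ≤ lik I p σ 1 ω m₁) :
      I.prior * x * lik I p σ 1 1 m₁ * v m₁ + (1 - I.prior) * y * lik I p σ 1 0 m₁ * v m₁ =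
        value u (I.prior * x * lik I p σ 1 1 m₁) ((1 - I.prior) * y * lik I p σ 1 0 m₁) := by
    rw [mul_assoc I.prior, mul_assoc (1 - I.prior), hv]
    simp only [belief_pair]
    exact value_posterior (mul_nonneg hπ (mul_nonneg (h₀ 1) (h₁ 1)))
      (mul_nonneg hπ' (mul_nonneg (h₀ 0) (h₁ 0)))
  have hi (ω : Fin 2) := h.integrable_mul (integrable_value_belief hu ω h₀)
  have key : (fun s => I.prior * x * (rate p σ 1 s * (I.f 1 s * v (some s))) +
      (1 - I.prior) * y * (rate p σ 1 s * (I.f 0 s * v (some s))))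
      =ᵐ[volume.restrict (Icc I.lo I.hi)]
      fun s => rate p σ 1 s * value u (I.prior * x * I.f 1 s) ((1 - I.prior) * y * I.f 0 s) := by
    filter_upwards [f_eq_lik I p σ 1] with s hs
    rw [hs.2, hs.2, mul_left_comm _ (I.mix s), mul_left_comm _ (I.mix s),
      value_mul (I.mix_nonneg s), ← hval (some s) fun ω => lik_some_nonneg 1 ω hs.1]
    ring
  have e := integral_congr_ae key
  rw [integral_add ((hi 1).const_mul _) ((hi 0).const_mul _), integral_const_mul,
    integral_const_mul] at e
  have e2 := hval none (lik_none_nonneg h)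
  simp only [lik, ndProb_eq_silence h] at e2
  simp only [valueAfter, hearing, msgExp_eq h]
  linear_combination e + e2

lemma abs_valueAfter_le (hu : ∀ a ω, |u a ω| ≤ K) (h : IsRate I (rate p σ 1)) (ω : Fin 2)
    {m₀ : Option ℝ} (h₀ : ∀ ω, 0 ≤ lik I p σ 0 ω m₀) : |valueAfter u I p σ ω m₀| ≤ K := by
  have h1 : |∫ s in Icc I.lo I.hi, rate p σ 1 s * (I.f ω s * value u (belief I p σ ![m₀, some s])
      (1 - belief I p σ ![m₀, some s]))| ≤ ∫ s in Icc I.lo I.hi, K * (rate p σ 1 s * I.f ω s) := by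
    rw [← Real.norm_eq_abs]
    refine norm_integral_le_of_norm_le ((h.integrable ω).const_mul K) ?_
    rw [ae_restrict_iff' measurableSet_Icc]
    refine .of_forall fun s hs => ?_
    have h3 := mul_nonneg (h.nonneg s hs) (I.f_nonneg ω s)
    rw [← mul_assoc, Real.norm_eq_abs, abs_mul, abs_of_nonneg h3, mul_comm K]
    exact mul_le_mul_of_nonneg_left
      (abs_value_belief_le hu h₀ fun ω => lik_some_nonneg 1 ω hs) h3
  have h2 := abs_value_belief_le hu h₀ (lik_none_nonneg h)
  have h3 := silence_pos h ω
  rw [integral_const_mul] at h1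
  rw [valueAfter, msgExp_eq h]
  refine (abs_add_le _ _).trans ?_
  rw [abs_mul, abs_of_pos h3]
  have : ∫ s in Icc I.lo I.hi, rate p σ 1 s * I.f ω s = 1 - silence I (rate p σ 1) ω := by
    unfold silence
    ring
  rw [this] at h1
  nlinarith

lemma measurable_valueAfter_some (hu : ∀ a ω, |u a ω| ≤ K) (h : IsRate I (rate p σ 1))
    (ω : Fin 2) : Measurable fun s => valueAfter u I p σ ω (some s) := by
  simp only [valueAfter, msgExp_eq h]
  have h1 := h.measurable
  have h2 := I.f_measurable ω
  have h3 : Measurable fun z : ℝ × ℝ => value u (belief I p σ ![some z.1, some z.2])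
      (1 - belief I p σ ![some z.1, some z.2]) :=
    measurable_value_belief hu (fun ω => (measurable_lik_some I p σ 0 ω).comp measurable_fst)
      fun ω => (measurable_lik_some I p σ 1 ω).comp measurable_snd
  have h4 : Measurable fun s => value u (belief I p σ ![some s, none])
      (1 - belief I p σ ![some s, none]) :=
    measurable_value_belief hu (fun ω => measurable_lik_some I p σ 0 ω) fun ω => measurable_const
  refine Measurable.add ?_ (h4.const_mul _)
  refine StronglyMeasurable.measurable (StronglyMeasurable.integral_prod_right'
    (f := fun z : ℝ × ℝ => rate p σ 1 z.2 * (I.f ω z.2 * value u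
      (belief I p σ ![some z.1, some z.2]) (1 - belief I p σ ![some z.1, some z.2]))) ?_)
  exact Measurable.stronglyMeasurable (by fun_prop)

lemma welfare_eq_hearingBoth (hu : ∀ a ω, |u a ω| ≤ K) (h : ∀ k, IsRate I (rate p σ k)) :
    welfare I p σ u = hearingBoth u I (rate p σ 0) (rate p σ 1) := by
  have hi (ω : Fin 2) : IntegrableOn (fun s => rate p σ 0 s *
      (I.f ω s * valueAfter u I p σ ω (some s))) (Icc I.lo I.hi) := by
    refine (h 0).integrable_mul (Integrable.mul_bdd (c := K) (I.integrableOn_f ω)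
      (measurable_valueAfter_some hu (h 1) ω).aestronglyMeasurable ?_)
    rw [ae_restrict_iff' measurableSet_Icc]
    exact .of_forall fun s hs => abs_valueAfter_le hu (h 1) ω fun ω => lik_some_nonneg 0 ω hs
  have key : (fun s => I.prior * (rate p σ 0 s * (I.f 1 s * valueAfter u I p σ 1 (some s))) +
      (1 - I.prior) * (rate p σ 0 s * (I.f 0 s * valueAfter u I p σ 0 (some s))))
      =ᵐ[volume.restrict (Icc I.lo I.hi)]
      fun s => rate p σ 0 s *
        hearing u I (rate p σ 1) (I.prior * I.f 1 s) ((1 - I.prior) * I.f 0 s) := by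
    filter_upwards [f_eq_lik I p σ 0] with s hs
    rw [hs.2, hs.2, mul_left_comm _ (I.mix s), mul_left_comm _ (I.mix s),
      hearing_mul (I.mix_nonneg s),
      ← valueAfter_eq_hearing hu (h 1) fun ω => lik_some_nonneg 0 ω hs.1]
    ring
  have e := integral_congr_ae key
  rw [integral_add ((hi 1).const_mul _) ((hi 0).const_mul _), integral_const_mul,
    integral_const_mul] at e
  have e2 := valueAfter_eq_hearing hu (h 1) (lik_none_nonneg (h 0))
  simp only [lik, ndProb_eq_silence (h 0)] at e2
  have e3 (ω : Fin 2) : msgExp I p σ 0 ω (fun m₀ => msgExp I p σ 1 ω (fun m₁ =>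
      ⨆ a, (belief I p σ ![m₀, m₁] * u a 1 + (1 - belief I p σ ![m₀, m₁]) * u a 0))) =
      (∫ s in Icc I.lo I.hi, rate p σ 0 s * (I.f ω s * valueAfter u I p σ ω (some s))) +
        silence I (rate p σ 0) ω * valueAfter u I p σ ω none := msgExp_eq (h 0) ω _
  simp only [welfare, e3, hearingBoth]
  linear_combination e + e2

lemma rate_ae_le (hp : ∀ k, p k ∈ Ioo (0 : ℝ) 1) {t t' : Fin 2 → ℝ} (h : HasThresholds I σ t)
    (h' : HasThresholds I σ' t') {k : Fin 2} (hk : t k ≤ t' k) :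
    rate p σ' k ≤ᵐ[volume.restrict (Icc I.lo I.hi)] rate p σ k := by
  filter_upwards [h.rate_ae_eq (p := p) k, h'.rate_ae_eq (p := p) k] with s hs hs'
  rw [hs, hs']
  exact cutoff_le_cutoff (hp k).1.le le_rfl hk s

/-- Among equilibria with ordered thresholds, the lower one is better for the decision maker. -/
lemma welfare_le (hp : ∀ k, p k ∈ Ioo (0 : ℝ) 1) (hu : ∀ a ω, |u a ω| ≤ K) {t t' : Fin 2 → ℝ}
    (hσ : IsEquilibrium I p c σ) (hσ' : IsEquilibrium I p c σ') (h : HasThresholds I σ t)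
    (h' : HasThresholds I σ' t') (hk : ∀ k, t k ≤ t' k) : welfare I p σ' u ≤ welfare I p σ u := by
  have hr := hσ.isRate hp
  have hr' := hσ'.isRate hp
  rw [welfare_eq_hearingBoth hu hr, welfare_eq_hearingBoth hu hr']
  exact hearingBoth_mono hu (hr' 0) (hr' 1) (hr 0) (hr 1) (rate_ae_le hp h h' (hk 0))
    (rate_ae_le hp h h' (hk 1))

end

section

/-! ### A lower disclosure cost can deter a sender -/

/-- Merging all disclosed signals into one message raises the residual uncertainty. -/
lemma residual_le_pooled {I : Info} {d : ℝ → ℝ} (h : IsRate I d) {η : ℝ} (h0 : 0 < η) (h1 : η < 1)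
    (hs : ∀ ω, silence I d ω < 1) : residual I d η ≤
      psi η (1 - silence I d 1) (1 - silence I d 0) + psi η (silence I d 1) (silence I d 0) := by
  have px := sub_pos.2 (hs 1)
  have py := sub_pos.2 (hs 0)
  have e (ω : Fin 2) : ∫ s in Icc I.lo I.hi, d s * I.f ω s = 1 - silence I d ω := by
    unfold silence
    ring
  refine add_le_add ?_ le_rfl
  rw [← psi_eq_tangent h0 h1 px py]
  set x₀ := 1 - silence I d 1
  set y₀ := 1 - silence I d 0
  set a := (1 - η) * y₀ ^ 2 / (η * x₀ + (1 - η) * y₀) ^ 2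
  set b := η * x₀ ^ 2 / (η * x₀ + (1 - η) * y₀) ^ 2
  calc _ ≤ ∫ s in Icc I.lo I.hi, (a * (d s * I.f 1 s) + b * (d s * I.f 0 s)) := by
        refine setIntegral_mono_on (h.integrable_mul (integrableOn_psi_f I h0 h1))
          (((h.integrable 1).const_mul a).add ((h.integrable 0).const_mul b)) measurableSet_Icc
          fun s hs => ?_
        have := mul_le_mul_of_nonneg_left
          (psi_le_tangent h0 h1 (I.f_nonneg 1 s) (I.f_nonneg 0 s) px py) (h.nonneg s hs)
        calc _ ≤ _ := this
          _ = _ := by ring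
    _ = _ := by
        rw [integral_add ((h.integrable 1).const_mul a) ((h.integrable 0).const_mul b),
          integral_const_mul, integral_const_mul, e, e]

/-- Silence moves beliefs little if the sender is unlikely to be informed. -/
lemma mul_prior_le_silenceBelief {I : Info} {d : ℝ → ℝ} (h : IsRate I d) {r : ℝ}
    (hr : r < 1) (hd : ∀ s ∈ Icc I.lo I.hi, d s ≤ r) : (1 - r) * I.prior ≤ silenceBelief I d := by
  have hr0 : 0 ≤ r := (h.nonneg _ ⟨le_rfl, I.lo_lt_hi.le⟩).trans (hd _ ⟨le_rfl, I.lo_lt_hi.le⟩)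
  have h1 : 1 - r ≤ silence I d 1 := by
    have h2 := silence_sub h (isRate_const I hr0 hr) 1
    have h3 : 0 ≤ ∫ s in Icc I.lo I.hi, (r - d s) * I.f 1 s :=
      setIntegral_nonneg measurableSet_Icc fun s hs =>
        mul_nonneg (sub_nonneg.2 (hd s hs)) (I.f_nonneg _ _)
    rw [silence_const] at h2
    linarith
  have hπ := I.prior_pos
  have hπ' := I.one_sub_prior_pos
  have p1 := silence_pos h 1
  have p0 := silence_pos h 0
  have l1 := silence_le_one h 1
  have l0 := silence_le_one h 0
  unfold silenceBelief
  rw [le_div_iff₀ (by positivity)]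
  have hD : I.prior * silence I d 1 + (1 - I.prior) * silence I d 0 ≤ 1 := by nlinarith
  calc (1 - r) * I.prior * (I.prior * silence I d 1 + (1 - I.prior) * silence I d 0)
      ≤ (1 - r) * I.prior * 1 :=
        mul_le_mul_of_nonneg_left hD (mul_nonneg (sub_nonneg.2 hr.le) hπ.le)
    _ ≤ _ := by nlinarith

/-- Fundamental theorem of calculus for an integrand that is cut off above `κ`. -/
lemma integral_cut {g G : ℝ → ℝ} (hG : ∀ x, HasDerivAt G (g x) x) (hg : Continuous g) (κ a b : ℝ) :
    IntervalIntegrable (fun s => if s ≤ κ then g s else 0) volume a b ∧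
      ∫ s in a..b, (if s ≤ κ then g s else 0) = G (min b κ) - G (min a κ) := by
  have hi : IntervalIntegrable (fun s => if s ≤ κ then g s else 0) volume a b := by
    have h := hg.intervalIntegrable (μ := volume) a b
    have : (fun s => if s ≤ κ then g s else 0) = (Iic κ).indicator g := by
      ext s
      simp [indicator_apply]
    rw [this]
    exact ⟨h.1.indicator measurableSet_Iic, h.2.indicator measurableSet_Iic⟩
  have hGc : Continuous G := continuous_iff_continuousAt.2 fun x => (hG x).continuousAt
  refine ⟨hi, integral_eq_of_hasDerivAt_off_countable (fun x => G (min x κ)) _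
    (countable_singleton κ) (hGc.comp (continuous_id.min continuous_const)).continuousOn
    (fun x hx => ?_) hi⟩
  rcases lt_or_gt_of_ne hx.2 with h | h
  · rw [if_pos h.le]
    refine (hG x).congr_of_eventuallyEq ?_
    filter_upwards [gt_mem_nhds h] with y hy
    rw [min_eq_left hy.le]
  · rw [if_neg h.not_ge]
    refine (hasDerivAt_const x (G κ)).congr_of_eventuallyEq ?_
    filter_upwards [lt_mem_nhds h] with y hy
    rw [min_eq_right hy.le]

/-- A signal density on `[0, 1]` that is uniform but for a concentration on `(4/5, 19/20]`. -/
noncomputable def bump (s : ℝ) : ℝ :=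
  3 / 4 + (if s ≤ 19 / 20 then 5 / 3 else 0) - (if s ≤ 4 / 5 then 5 / 3 else 0)

lemma bump_pos (s : ℝ) : 0 < bump s := by
  unfold bump
  split_ifs <;> linarith

lemma measurable_bump : Measurable bump := by
  unfold bump
  exact (measurable_const.add (Measurable.ite measurableSet_Iic measurable_const
    measurable_const)).sub (Measurable.ite measurableSet_Iic measurable_const measurable_const)

/-- Integral over `[a, b]` of the product of `bump` and the derivative of `G`. -/
noncomputable def bumpPrimitive (G : ℝ → ℝ) (a b : ℝ) : ℝ :=
  3 / 4 * (G b - G a) + 5 / 3 * (G (min b (19 / 20)) - G (min a (19 / 20))) -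
    5 / 3 * (G (min b (4 / 5)) - G (min a (4 / 5)))

lemma integral_mul_bump {g G : ℝ → ℝ} (hG : ∀ x, HasDerivAt G (g x) x) (hg : Continuous g)
    (a b : ℝ) : IntervalIntegrable (fun s => g s * bump s) volume a b ∧
      ∫ s in a..b, g s * bump s = bumpPrimitive G a b := by
  obtain ⟨h1, e1⟩ := integral_cut hG hg (19 / 20) a b
  obtain ⟨h2, e2⟩ := integral_cut hG hg (4 / 5) a b
  have h0 := hg.intervalIntegrable (μ := volume) a b
  have e0 := intervalIntegral.integral_eq_sub_of_hasDerivAt (fun x _ => hG x) h0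
  have e : (fun s => g s * bump s) = fun s => 3 / 4 * g s +
      5 / 3 * (if s ≤ 19 / 20 then g s else 0) - 5 / 3 * (if s ≤ 4 / 5 then g s else 0) := by
    ext s
    unfold bump
    split_ifs <;> ring
  rw [e]
  refine ⟨((h0.const_mul _).add (h1.const_mul _)).sub (h2.const_mul _), ?_⟩
  rw [intervalIntegral.integral_sub ((h0.const_mul _).add (h1.const_mul _)) (h2.const_mul _),
    intervalIntegral.integral_add (h0.const_mul _) (h1.const_mul _)]
  simp only [intervalIntegral.integral_const_mul, e0, e1, e2, bumpPrimitive]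

/-- The factor by which `bump` is to be multiplied to get the density in state `ω`: signals are
posteriors, and `19/32` is the prior. -/
noncomputable def bumpWeight (ω : Fin 2) (s : ℝ) : ℝ :=
  if ω = 1 then 32 / 19 * s else 32 / 13 * (1 - s)

/-- A primitive of `bumpWeight`. -/
noncomputable def bumpWeightPrimitive (ω : Fin 2) (s : ℝ) : ℝ :=
  if ω = 1 then 16 / 19 * s ^ 2 else 32 / 13 * (s - s ^ 2 / 2)

lemma hasDerivAt_bumpWeightPrimitive (ω : Fin 2) (s : ℝ) :
    HasDerivAt (bumpWeightPrimitive ω) (bumpWeight ω s) s := by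
  unfold bumpWeight bumpWeightPrimitive
  split_ifs
  · have := (hasDerivAt_pow 2 s).const_mul (16 / 19 : ℝ)
    refine this.congr_deriv ?_
    norm_num
    ring
  · have := ((hasDerivAt_id s).sub ((hasDerivAt_pow 2 s).div_const 2)).const_mul (32 / 13 : ℝ)
    refine this.congr_deriv ?_
    norm_num

lemma continuous_bumpWeight (ω : Fin 2) : Continuous (bumpWeight ω) := by
  unfold bumpWeight
  split_ifs <;> fun_prop

/-- The signal density in state `ω`. -/
noncomputable def bumpDensity (ω : Fin 2) : ℝ → ℝ :=
  (Icc 0 1).indicator fun s => bumpWeight ω s * bump s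

lemma setIntegral_bumpDensity (ω : Fin 2) {a b : ℝ} (ha : 0 ≤ a) (hab : a ≤ b) (hb : b ≤ 1) :
    IntervalIntegrable (fun s => bumpWeight ω s * bump s) volume a b ∧
    ∫ s in Ioc a b, bumpDensity ω s = ∫ s in a..b, bumpWeight ω s * bump s := by
  refine ⟨(integral_mul_bump (hasDerivAt_bumpWeightPrimitive ω)
    (continuous_bumpWeight ω) a b).1, ?_⟩
  rw [intervalIntegral.integral_of_le hab]
  refine setIntegral_congr_fun measurableSet_Ioc fun s hs => ?_
  exact indicator_of_mem (show s ∈ Icc (0 : ℝ) 1 from ⟨ha.trans hs.1.le, hs.2.trans hb⟩) _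

lemma bumpWeight_pos (ω : Fin 2) {s : ℝ} (hs : s ∈ Ioo (0 : ℝ) 1) : 0 < bumpWeight ω s := by
  unfold bumpWeight
  split_ifs <;> linarith [hs.1, hs.2]

lemma bumpWeight_nonneg (ω : Fin 2) {s : ℝ} (hs : s ∈ Icc (0 : ℝ) 1) : 0 ≤ bumpWeight ω s := by
  unfold bumpWeight
  split_ifs <;> linarith [hs.1, hs.2]

/-- The information structure with unconditional signal density `bump`. -/
noncomputable def bumpInfo : Info where
  lo := 0
  hi := 1
  lo_nonneg := le_rfl
  lo_lt_hi := one_pos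
  hi_le_one := le_rfl
  prior := 19 / 32
  prior_mem := by constructor <;> norm_num
  f := bumpDensity
  f_measurable ω := ((continuous_bumpWeight ω).measurable.mul measurable_bump).indicator
    measurableSet_Icc
  f_nonneg ω s := indicator_nonneg (fun _ hs => mul_nonneg (bumpWeight_nonneg ω hs)
    (bump_pos _).le) s
  f_total ω := by
    rw [integral_Icc_eq_integral_Ioc, (setIntegral_bumpDensity ω le_rfl zero_le_one le_rfl).2,
      (integral_mul_bump (hasDerivAt_bumpWeightPrimitive ω) (continuous_bumpWeight ω) 0 1).2]
    unfold bumpPrimitive bumpWeightPrimitive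
    split_ifs <;> norm_num [min_def]
  f_support ω a b ha hab hb := by
    obtain ⟨hi, e⟩ := setIntegral_bumpDensity ω ha hab.le hb
    rw [integral_Icc_eq_integral_Ioc, e]
    exact intervalIntegral.intervalIntegral_pos_of_pos_on hi (fun s hs => mul_pos
      (bumpWeight_pos ω ⟨ha.trans_lt hs.1, hs.2.trans_le hb⟩) (bump_pos s)) hab
  f_posterior := by
    refine .of_forall fun s hs => ?_
    simp only [bumpDensity, indicator_of_mem hs, bumpWeight]
    norm_num
    ring

lemma silence_bumpInfo {r z : ℝ} (hz : z ∈ Icc (0 : ℝ) 1) (ω : Fin 2) :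
    silence bumpInfo (cutoff r z) ω = 1 - r * bumpPrimitive (bumpWeightPrimitive ω) z 1 := by
  have h1 : ∫ s in Icc (0 : ℝ) 1, cutoff r z s * bumpDensity ω s =
      r * ∫ s in Ioc z 1, bumpDensity ω s := by
    have : (fun s => cutoff r z s * bumpDensity ω s) =
        (Ioi z).indicator fun s => r * bumpDensity ω s := by
      ext s
      by_cases h : z < s <;> simp [cutoff, h]
    rw [this, setIntegral_indicator measurableSet_Ioi, integral_const_mul]
    congr 3
    ext s
    simp only [mem_inter_iff, mem_Icc, mem_Ioi, mem_Ioc]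
    exact ⟨fun h => ⟨h.2, h.1.2⟩, fun h => ⟨⟨hz.1.trans h.1.le, h.2⟩, h.1⟩⟩
  change 1 - ∫ s in Icc (0 : ℝ) 1, cutoff r z s * bumpDensity ω s = _
  rw [h1, (setIntegral_bumpDensity ω hz.1 hz.2 le_rfl).2,
    (integral_mul_bump (hasDerivAt_bumpWeightPrimitive ω) (continuous_bumpWeight ω) z 1).2]

/-- The belief after silence of a sender with threshold `z`, in the regions that `bump` divides. -/
lemma silenceBelief_bumpInfo {z : ℝ} (hz : z ∈ Icc (0 : ℝ) 1) :
    ∃ N D, silenceBelief bumpInfo (cutoff (9 / 10) z) = N / D ∧ 0 < D ∧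
      ((z ≤ 4 / 5 ∧ N = 19 / 320 + 27 / 80 * z ^ 2 ∧ D = 1 / 10 + 27 / 40 * z) ∨
      (4 / 5 ≤ z ∧ z ≤ 19 / 20 ∧ N = 19 / 320 + 27 / 80 * z ^ 2 + 3 / 4 * (z ^ 2 - 16 / 25) ∧
        D = 1 / 10 + 27 / 40 * z + 3 / 2 * (z - 4 / 5)) ∨
      (19 / 20 ≤ z ∧ N = 19 / 320 + 27 / 80 * z ^ 2 + 63 / 320 ∧
        D = 1 / 10 + 27 / 40 * z + 9 / 40)) := by
  refine ⟨_, _, rfl, ?_, ?_⟩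
  · have h := isRate_cutoff bumpInfo (r := 9 / 10) (by constructor <;> norm_num) z
    have h1 := mul_pos bumpInfo.prior_pos (silence_pos h 1)
    have h0 := mul_pos bumpInfo.one_sub_prior_pos (silence_pos h 0)
    positivity
  rw [silence_bumpInfo hz, silence_bumpInfo hz]
  simp only [bumpInfo, bumpPrimitive, bumpWeightPrimitive]
  norm_num
  rcases le_total z (4 / 5) with h | h
  · left
    rw [min_eq_left h, min_eq_left (by linarith : z ≤ 19 / 20)]
    refine ⟨h, ?_, ?_⟩ <;> ring
  rcases le_total z (19 / 20) with h' | h'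
  · right; left
    rw [min_eq_right h, min_eq_left h']
    refine ⟨h, h', ?_, ?_⟩ <;> ring
  · right; right
    rw [min_eq_right h, min_eq_right h']
    refine ⟨h', ?_, ?_⟩ <;> ring

lemma sub_silenceBelief_lt {z : ℝ} (hz : z ∈ Icc (0 : ℝ) 1) (h : z < 19 / 20) :
    z - silenceBelief bumpInfo (cutoff (9 / 10) z) < 19 / 50 := by
  obtain ⟨N, D, e, hD, hc⟩ := silenceBelief_bumpInfo hz
  rw [e, sub_lt_comm, lt_div_iff₀ hD]
  have := hz.1
  rcases hc with ⟨h1, rfl, rfl⟩ | ⟨h1, h2, rfl, rfl⟩ | ⟨h1, rfl, rfl⟩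
  · nlinarith [mul_nonneg hz.1 (sub_nonneg.2 h1)]
  · nlinarith [mul_nonneg (sub_nonneg.2 h1) (sub_nonneg.2 h2)]
  · linarith

lemma lt_sub_silenceBelief {z : ℝ} (hz : z ∈ Icc (0 : ℝ) 1) (h : 4 / 5 < z) :
    7 / 20 < z - silenceBelief bumpInfo (cutoff (9 / 10) z) := by
  obtain ⟨N, D, e, hD, hc⟩ := silenceBelief_bumpInfo hz
  rw [e, lt_sub_comm, div_lt_iff₀ hD]
  rcases hc with ⟨h1, rfl, rfl⟩ | ⟨h1, h2, rfl, rfl⟩ | ⟨h1, rfl, rfl⟩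
  · linarith
  · nlinarith [sq_nonneg (z - 9 / 10), sq_nonneg (z - 4 / 5)]
  · nlinarith [mul_nonneg (sub_nonneg.2 h1) (sub_nonneg.2 h1)]

lemma silenceBelief_of_never (r : ℝ) : silenceBelief bumpInfo (cutoff r 1) = 19 / 32 := by
  simp only [silenceBelief, silence_bumpInfo (right_mem_Icc.2 zero_le_one), bumpPrimitive, sub_self]
  simp only [bumpInfo]
  norm_num

/-- Sender `l` is rarely informed, and the other one is nearly always informed. -/
noncomputable def bumpProb (l k : Fin 2) : ℝ := if k = l then 1 / 100 else 9 / 10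

lemma bumpProb_mem (l k : Fin 2) : bumpProb l k ∈ Ioo (0 : ℝ) 1 := by
  unfold bumpProb
  split_ifs <;> constructor <;> norm_num

lemma bumpProb_self (l : Fin 2) : bumpProb l l = 1 / 100 := if_pos rfl

lemma bumpProb_rev (l : Fin 2) : bumpProb l l.rev = 9 / 10 := by
  refine if_neg ?_
  fin_cases l <;> simp

/-- At a prohibitive cost, nobody discloses. -/
lemma eq_one_of_cost_two {l : Fin 2} {t : Fin 2 → ℝ}
    (h : IsEqThresholds bumpInfo (bumpProb l) 2 t) : t l = 1 := by
  obtain ⟨h1, -, h3⟩ := (isEqThresholds_iff (bumpProb_mem l)).1 h l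
  refine h3.resolve_right (not_le.2 ?_)
  have hη := silenceBelief_mem (isRate_cutoff bumpInfo (bumpProb_mem l l) (t l))
  have hr := isRate_cutoff bumpInfo (bumpProb_mem l l.rev) (t l.rev)
  have h5 := residual_le_one hr hη.1 hη.2
  have h6 := residual_pos hr hη.1 hη.2
  have h7 : t l ≤ 1 := h1.2
  unfold gap advantage
  nlinarith [hη.1]

/-- At the intermediate cost, the well-informed sender conceals signals in the concentration, and
then silence of his leaves disclosure attractive for the highest type of the other one. -/
lemma lt_one_of_cost_intermediate {l : Fin 2} {t : Fin 2 → ℝ}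
    (h : IsEqThresholds bumpInfo (bumpProb l) (19 / 50) t) : t l < 1 := by
  have h' := (isEqThresholds_iff (bumpProb_mem l)).1 h
  obtain ⟨h1, h2, -⟩ := h' l
  obtain ⟨m1, -, m3⟩ := h' l.rev
  refine lt_of_le_of_ne h1.2 fun hl => ?_
  have hrl := isRate_cutoff bumpInfo (bumpProb_mem l l) (t l)
  have hrm := isRate_cutoff bumpInfo (bumpProb_mem l l.rev) (t l.rev)
  -- Below `19 / 20` the threshold type would gain less than the cost, whatever sender `l` does.
  have hm : 19 / 20 ≤ t l.rev := by
    rcases m3 with m3 | m3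
    · have : t l.rev = 1 := m3
      rw [this]
      norm_num
    · by_contra! hlt
      have hη := silenceBelief_mem hrm
      have e1 := residual_le_one hrl hη.1 hη.2
      have e2 := residual_pos hrl hη.1 hη.2
      have e3 := sub_silenceBelief_lt m1 hlt
      unfold gap advantage at m3
      rw [Fin.rev_rev, bumpProb_rev] at m3
      rw [bumpProb_rev] at e1 e2
      rcases le_total (t l.rev - silenceBelief bumpInfo (cutoff (9 / 10) (t l.rev))) 0 with h0 | h0
      · nlinarith
      · nlinarith
  have hgap := h2.resolve_left (by rw [hl]; exact one_ne_zero)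
  unfold gap advantage at hgap
  rw [hl, silenceBelief_of_never, bumpProb_rev] at hgap
  rw [bumpProb_rev] at hrm
  -- The residual uncertainty is at least what silence contributes to it at threshold `19 / 20`.
  have hA := isRate_cutoff bumpInfo (r := 9 / 10) (by constructor <;> norm_num) (19 / 20)
  have e1 := residual_anti hrm hA (.of_forall (cutoff_le_cutoff (by norm_num) le_rfl hm))
    (η := 19 / 32) (by norm_num) (by norm_num)
  have e2 := psi_silence_le_residual hA (η := 19 / 32) (by norm_num) (by norm_num)
  rw [silence_bumpInfo (by constructor <;> norm_num),
    silence_bumpInfo (by constructor <;> norm_num)] at e2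
  norm_num [bumpPrimitive, bumpWeightPrimitive, psi] at e2
  linarith

/-- At the low cost, the well-informed sender discloses the whole concentration. This is so
informative that the other sender does not find any disclosure worth its cost. -/
lemma eq_one_of_cost_low {l : Fin 2} {t : Fin 2 → ℝ}
    (h : IsEqThresholds bumpInfo (bumpProb l) (69 / 200) t) : t l = 1 := by
  have h' := (isEqThresholds_iff (bumpProb_mem l)).1 h
  obtain ⟨h1, -, h3⟩ := h' l
  obtain ⟨m1, m2, -⟩ := h' l.rev
  have hrl := isRate_cutoff bumpInfo (bumpProb_mem l l) (t l)
  have hrm := isRate_cutoff bumpInfo (bumpProb_mem l l.rev) (t l.rev)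
  have hle : ∀ s ∈ Icc bumpInfo.lo bumpInfo.hi, cutoff (bumpProb l l) (t l) s ≤ 1 / 100 := by
    intro s _
    rw [bumpProb_self, cutoff]
    split_ifs <;> norm_num
  -- Sender `l` is rarely informed, so he scales the gain of the other one by `99 / 100` at least.
  have hm : t l.rev ≤ 4 / 5 := by
    by_contra! hlt
    have hgap := m2.resolve_left (by
      intro h0
      have : t l.rev = 0 := h0
      linarith)
    have hη := silenceBelief_mem hrm
    have e1 := one_sub_le_residual hrl (by norm_num) hle hη.1 hη.2
    have e3 := lt_sub_silenceBelief m1 hlt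
    unfold gap advantage at hgap
    rw [Fin.rev_rev, bumpProb_rev] at hgap
    rw [bumpProb_rev] at e1
    nlinarith
  refine h3.resolve_right (not_le.2 ?_)
  have hη := silenceBelief_mem hrl
  have hb := mul_prior_le_silenceBelief hrl (by norm_num) hle
  -- `1881 / 3200` is `99 / 100` times the prior `19 / 32`.
  have hb' : (1881 / 3200 : ℝ) ≤ silenceBelief bumpInfo (cutoff (bumpProb l l) (t l)) := by
    refine le_trans (le_of_eq ?_) hb
    simp only [bumpInfo]
    norm_num
  have hB := isRate_cutoff bumpInfo (r := 9 / 10) (by constructor <;> norm_num) (4 / 5)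
  have e1 := sub_mul_residual_anti hrm (bumpInfo.mem_unit h1) (by norm_num) hb' hη.2
  rw [bumpProb_rev] at hrm
  have e2 := residual_anti hB hrm (.of_forall (cutoff_le_cutoff (by norm_num) le_rfl hm))
    (η := 1881 / 3200) (by norm_num) (by norm_num)
  have e3 := residual_le_pooled hB (η := 1881 / 3200) (by norm_num) (by norm_num) (by
    intro ω
    rw [silence_bumpInfo (by constructor <;> norm_num)]
    unfold bumpPrimitive bumpWeightPrimitive
    split_ifs <;> norm_num [min_def])
  have e4 := residual_pos hrm (η := 1881 / 3200) (by norm_num) (by norm_num)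
  rw [silence_bumpInfo (by constructor <;> norm_num),
    silence_bumpInfo (by constructor <;> norm_num)] at e3
  norm_num [bumpPrimitive, bumpWeightPrimitive, psi] at e3
  have h7 : t l ≤ 1 := h1.2
  unfold gap advantage
  rw [bumpProb_rev] at e1 ⊢
  refine e1.trans_lt ?_
  nlinarith

end

end Disclosure

theorem proposition4 :
    -- no message cost or a concealment cost
    (∀ (I : Disclosure.Info) (p : Fin 2 → ℝ) (c : ℝ), (∀ k, p k ∈ Set.Ioo (0 : ℝ) 1) → c ≤ 0 →
      -- the smallest equilibrium exists and is best, the largest exists and is worst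
      ((∃ t, Disclosure.IsSmallest I p c t) ∧ (∃ t, Disclosure.IsLargest I p c t) ∧
        (∀ t σ, Disclosure.IsSmallest I p c t → Disclosure.IsEquilibrium I p c σ →
          Disclosure.HasThresholds I σ t → Disclosure.IsBestForDM I p c σ) ∧
        (∀ t σ, Disclosure.IsLargest I p c t → Disclosure.IsEquilibrium I p c σ →
          Disclosure.HasThresholds I σ t → Disclosure.IsWorstForDM I p c σ)) ∧
      -- an increase in the probability that one sender `i` is informed
      (∀ (i : Fin 2) (p' : Fin 2 → ℝ), (∀ k, p' k ∈ Set.Ioo (0 : ℝ) 1) →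
        p i ≤ p' i → p' i.rev = p i.rev →
        (∀ t t', Disclosure.IsSmallest I p c t → Disclosure.IsSmallest I p' c t' →
          ∀ k, t' k ≤ t k) ∧
        (∀ t t', Disclosure.IsLargest I p c t → Disclosure.IsLargest I p' c t' →
          ∀ k, t' k ≤ t k)) ∧
      -- a decrease in the message cost
      (∀ c' : ℝ, c' ≤ c →
        (∀ t t', Disclosure.IsSmallest I p c t → Disclosure.IsSmallest I p c' t' →
          ∀ k, t' k ≤ t k) ∧
        (∀ t t', Disclosure.IsLargest I p c t → Disclosure.IsLargest I p c' t' →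
          ∀ k, t' k ≤ t k))) ∧
    -- a disclosure cost: an increase in the probability that one sender `i` is informed
    (∀ (I : Disclosure.Info) (p : Fin 2 → ℝ) (c : ℝ), (∀ k, p k ∈ Set.Ioo (0 : ℝ) 1) → 0 < c →
      (∀ k, ∃ t, Disclosure.IsMaximalFor I p c k t) ∧
      (∀ (i : Fin 2) (p' : Fin 2 → ℝ), (∀ k, p' k ∈ Set.Ioo (0 : ℝ) 1) →
        p i ≤ p' i → p' i.rev = p i.rev →
        ∀ k t t', Disclosure.IsMaximalFor I p c k t → Disclosure.IsMaximalFor I p' c k t' →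
          t' i ≤ t i ∧ t i.rev ≤ t' i.rev)) ∧
    -- a decrease in the disclosure cost from `c` to `c'` can strictly lower and can strictly raise
    -- the threshold of either sender `l` in the `k`-maximal equilibrium, for either `k`
    (∀ k l : Fin 2, ∃ (I : Disclosure.Info) (p : Fin 2 → ℝ), (∀ j, p j ∈ Set.Ioo (0 : ℝ) 1) ∧
      (∃ (c c' : ℝ) (t t' : Fin 2 → ℝ), 0 < c' ∧ c' < c ∧
        Disclosure.IsMaximalFor I p c k t ∧ Disclosure.IsMaximalFor I p c' k t' ∧ t' l < t l) ∧
      (∃ (c c' : ℝ) (t t' : Fin 2 → ℝ), 0 < c' ∧ c' < c ∧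
        Disclosure.IsMaximalFor I p c k t ∧ Disclosure.IsMaximalFor I p c' k t' ∧ t l < t' l)) := by
  open Disclosure in
  have hsign (k i : Fin 2) : maximalSign k i * maximalSign k i.rev = -1 := by
    fin_cases k <;> fin_cases i <;> simp [maximalSign]
  have hsub (k : Fin 2) {c : ℝ} (hc : 0 ≤ c) : maximalSign k 0 * maximalSign k 1 * c ≤ 0 := by
    have : maximalSign k 0 * maximalSign k 1 = -1 := hsign k 0
    rw [this]
    linarith
  have hmax (I : Info) {p : Fin 2 → ℝ} (hp : ∀ k, p k ∈ Set.Ioo (0 : ℝ) 1) (k : Fin 2) {c : ℝ}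
      (hc : 0 ≤ c) : ∃ t, IsMaximalFor I p c k t := by
    obtain ⟨t, ht, -⟩ := exists_isExtremal I hp (maximalSign_eq k) (hsub k hc)
    exact ⟨t, (isMaximalFor_iff hp).2 ht⟩
  refine ⟨fun I p c hp hc => ⟨⟨?_, ?_, fun t σ ht hσ hσt => ⟨hσ, ?_⟩, fun t σ ht hσ hσt =>
    ⟨hσ, ?_⟩⟩, fun i p' hp' hi hj => ⟨fun t t' ht ht' k => ?_, fun t t' ht ht' k => ?_⟩,
    fun c' hc' => ⟨fun t t' ht ht' => ?_, fun t t' ht ht' => ?_⟩⟩,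
    fun I p c hp hc => ⟨fun k => hmax I hp k hc.le, fun i p' hp' hi hj k t t' ht ht' => ?_⟩,
    fun k l => ⟨bumpInfo, bumpProb l, bumpProb_mem l, ?_, ?_⟩⟩
  · obtain ⟨t, ht, -⟩ := exists_isExtremal I hp (e := fun _ => -1) (by simp) (by linarith)
    exact ⟨t, (isSmallest_iff hp).2 ht⟩
  · obtain ⟨t, ht, -⟩ := exists_isExtremal I hp (e := fun _ => 1) (by simp) (by linarith)
    exact ⟨t, (isLargest_iff hp).2 ht⟩
  · rintro A _ u ⟨K, hu⟩ σ' hσ'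
    obtain ⟨t', ht', hk⟩ := ht.2 σ' hσ'
    exact welfare_le hp hu hσ hσ' hσt ht' hk
  · rintro A _ u ⟨K, hu⟩ σ' hσ'
    obtain ⟨t', ht', hk⟩ := ht.2 σ' hσ'
    exact welfare_le hp hu hσ' hσ ht' hσt hk
  · have := ((isSmallest_iff hp).1 ht).of_prob_le hp hp' (by simp) (by linarith) hi hj
      ((isSmallest_iff hp').1 ht') k
    linarith
  · have := ((isLargest_iff hp).1 ht).of_prob_le hp hp' (by simp) (by linarith) hi hj
      ((isLargest_iff hp').1 ht') k
    linarith
  · exact ((isSmallest_iff hp).1 ht).of_cost_le hp (.inr rfl) hc hc' ((isSmallest_iff hp).1 ht')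
  · exact ((isLargest_iff hp).1 ht).of_cost_le hp (.inl rfl) hc hc' ((isLargest_iff hp).1 ht')
  · have h := ((isMaximalFor_iff hp).1 ht).of_prob_le hp hp' (maximalSign_eq k) (hsub k hc.le) hi hj
      ((isMaximalFor_iff hp').1 ht')
    have h1 := h i
    have h2 := h i.rev
    rw [← mul_assoc, ← mul_assoc, hsign] at h2
    refine ⟨?_, by linarith⟩
    rcases maximalSign_eq k i with hk | hk <;> rw [hk] at h1 <;> linarith
  · obtain ⟨t, ht⟩ := hmax bumpInfo (bumpProb_mem l) k (c := 2) (by norm_num)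
    obtain ⟨t', ht'⟩ := hmax bumpInfo (bumpProb_mem l) k (c := 19 / 50) (by norm_num)
    refine ⟨2, 19 / 50, t, t', by norm_num, by norm_num, ht, ht', ?_⟩
    rw [eq_one_of_cost_two ht.1]
    exact lt_one_of_cost_intermediate ht'.1
  · obtain ⟨t, ht⟩ := hmax bumpInfo (bumpProb_mem l) k (c := 19 / 50) (by norm_num)
    obtain ⟨t', ht'⟩ := hmax bumpInfo (bumpProb_mem l) k (c := 69 / 200) (by norm_num)
    refine ⟨19 / 50, 69 / 200, t, t', by norm_num, by norm_num, ht, ht', ?_⟩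
    rw [eq_one_of_cost_low ht'.1]
    exact lt_one_of_cost_intermediate ht.1
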